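/- **Setting.** Let $(\overline M,\overline g)$ be a smooth $(n+2)$-dimensional Lorentzian manifold with Levi-Civita connection $\overline\nabla$, and let $M$ be a lightlike (immersed) hypersurface of $\overline M$: its induced metric $g=\langle\cdot,\cdot\rangle$ is degenerate, with radical distribution $\mathrm{Rad}TM=TM\cap TM^{\perp}$ spanned by a globally defined nowhere zero smooth vector field $\xi$. Let $S(TM)$ be a screen distribution, i.e. a smooth rank $n$ distribution on $M$ complementary to $\mathrm{Rad}TM$ in $TM$, and let $P:TM\to S(TM)$ be the projection along $\mathrm{Rad}TM$. Let $N$ be the unique vector field along $M$ with $\overline g(N,\xi)=1$, $\overline g(N,N)=0$ and $\overline g(N,W)=0$ for $W\in S(TM)$; put $tr(TM)=\mathrm{span}\{N\}$, so that $T\overline M|_M=TM\oplus tr(TM)$, and put $\eta=\overline g(N,\cdot)$ on $TM$. The induced connection on $M$ is $\nabla_XY=Q(\overline\nabla_XY)$, where $Q$ is the projection onto $TM$ along $tr(TM)$. Assume that $M$ is totally geodesic, i.e. $h(X,Y)=\overline\nabla_XY-\nabla_XY$ vanishes. Let $X^\flat=g(X,\cdot)+\eta(X)\eta$; the map $\flat:TM\to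 T^*M$ is an isomorphism, and the gradient $\nabla^gf$ of a smooth function $f$ is defined by $(\nabla^gf)^\flat=df$. For a smooth field of endomorphisms $S$ of $TM$ put $\nabla S(X,Y)=(\nabla_XS)Y=\nabla_X(SY)-S(\nabla_XY)$. $S$ is an $\mathcal A^\nabla$-tensor if $PS=SP$, $\langle SX,Y\rangle=\langle X,SY\rangle$ for all $X,Y$, and $X^\flat(\nabla S(X,X))=0$ for all $X$. **Theorem 5.1.** Let $S$ be an $\mathcal A^\nabla$-tensor on $(M,g,S(TM))$ with exactly three eigenfunctions $\lambda_0,\alpha,\beta$; that is, $\lambda_0,\alpha,\beta$ are smooth functions on $M$ which are pairwise distinct at each point $x$, the eigenvalues of $S_x$ are exactly $\lambda_0(x),\alpha(x),\beta(x)$, and $\mathrm{Ker}(S-\lambda_0I)=\mathrm{Rad}TM$. Suppose that $\lambda_0$ is constant and that $S$ has constant trace. Then $\nabla^g\alpha$ and $\nabla^g\beta$ are $\mathrm{Rad}TM$-valued. If, moreover, the screen distribution is totally geodesic (its second fundamental form vanishes: for all $X\in\Gamma(TM)$ and $Y\in\Gamma(S(TM))$ the $\mathrm{Rad}TM$-component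 $h^*(X,Y)$ of $\nabla_XY$ is zero), then the distributions $D_\alpha=\mathrm{Ker}(S-\alpha I)$ and $D_\beta=\mathrm{Ker}(S-\beta I)$ are both integrable (their smooth sections are closed under the Lie bracket) if and only if $\nabla S(X,Y)=0$ for all $X,Y\in\Gamma(S(TM))$. -/

import Mathlib

open scoped Manifold ContDiff

noncomputable section

namespace Lightlike

/-- The standard model space of dimension `m`. -/
abbrev Model (m : ℕ) : Type := EuclideanSpace ℝ (Fin m)

/-- The tangent space at `x` of a manifold of dimension `m`. -/
abbrev Tan (m : ℕ) {M : Type*} [TopologicalSpace M] [ChartedSpace (Model m) M] (x : M) : Type :=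
  TangentSpace (𝓡 m) x

instance (m : ℕ) {M : Type*} [TopologicalSpace M] [ChartedSpace (Model m) M] (x : M) :
    FiniteDimensional ℝ (Tan m x) :=
  inferInstanceAs (FiniteDimensional ℝ (Model m))

theorem finrank_tan (m : ℕ) {M : Type*} [TopologicalSpace M] [ChartedSpace (Model m) M] (x : M) :
    Module.finrank ℝ (Tan m x) = m := by
  have h : Module.finrank ℝ (Model m) = m := by simp
  exact h

section Basic

variable {m : ℕ} {M : Type*} [TopologicalSpace M] [ChartedSpace (Model m) M]
  [IsManifold (𝓡 m) ∞ M]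

/-- `X ∈ Γ(TM)`: a globally defined smooth vector field. -/
def IsSmoothField (X : Π x : M, Tan m x) : Prop :=
  ContMDiff (𝓡 m) ((𝓡 m).prod 𝓘(ℝ, Model m)) ∞
    (fun x ↦ Bundle.TotalSpace.mk' (Model m) x (X x))

/-- `X ∈ Γ(D)`: a smooth vector field with values in the family of subspaces `D`. -/
def IsSmoothSectionOf (D : Π x : M, Submodule ℝ (Tan m x)) (X : Π x : M, Tan m x) : Prop :=
  IsSmoothField X ∧ ∀ x, X x ∈ D x

/-- A smooth field of endomorphisms of the tangent bundle. -/
def IsSmoothEndomorphism (S : Π x : M, Tan m x →L[ℝ] Tan m x) : Prop :=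
  ContMDiff (𝓡 m) ((𝓡 m).prod 𝓘(ℝ, Model m →L[ℝ] Model m)) ∞
    (fun x ↦ Bundle.TotalSpace.mk' (Model m →L[ℝ] Model m)
      (E := fun x : M ↦ Tan m x →L[ℝ] Tan m x) x (S x))

/-- `D` is a smooth distribution of rank `k`: near every point it has a smooth frame of `k`
local vector fields. -/
def IsSmoothDistribution (k : ℕ) (D : Π x : M, Submodule ℝ (Tan m x)) : Prop :=
  ∀ x : M, ∃ U : Set M, IsOpen U ∧ x ∈ U ∧ ∃ s : Fin k → Π y : M, Tan m y,
    (∀ j, ContMDiffOn (𝓡 m) ((𝓡 m).prod 𝓘(ℝ, Model m)) ∞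
      (fun y ↦ Bundle.TotalSpace.mk' (Model m) y (s j y)) U) ∧
    ∀ y ∈ U, LinearIndependent ℝ (fun j ↦ s j y) ∧
      Submodule.span ℝ (Set.range fun j ↦ s j y) = D y

/-- Integrability (involutivity) of a distribution: `Γ(D)` is closed under the Lie bracket. -/
def IsIntegrable (D : Π x : M, Submodule ℝ (Tan m x)) : Prop :=
  ∀ X Y : Π x : M, Tan m x, IsSmoothSectionOf D X → IsSmoothSectionOf D Y →
    ∀ x, VectorField.mlieBracket (𝓡 m) X Y x ∈ D x

/-- The eigenspace distribution `x ↦ Ker (S_x - f(x) I)`. -/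
def eigenDistribution (S : Π x : M, Tan m x →L[ℝ] Tan m x) (f : M → ℝ) (x : M) :
    Submodule ℝ (Tan m x) :=
  Module.End.eigenspace (S x : Tan m x →ₗ[ℝ] Tan m x) (f x)

end Basic

/-- A smooth Lorentzian metric, of signature `(-, +, …, +)`. -/
structure LorentzMetric (m : ℕ) (M : Type*) [TopologicalSpace M] [ChartedSpace (Model m) M]
    [IsManifold (𝓡 m) ∞ M] where
  form (p : M) : Tan m p →L[ℝ] Tan m p →L[ℝ] ℝ
  symm (p : M) (u v : Tan m p) : form p u v = form p v u
  signature (p : M) : ∃ t : Tan m p, form p t t < 0 ∧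
    ∀ v : Tan m p, form p t v = 0 → v ≠ 0 → 0 < form p v v
  smooth : ContMDiff (𝓡 m) ((𝓡 m).prod 𝓘(ℝ, Model m →L[ℝ] Model m →L[ℝ] ℝ)) ∞
    (fun p ↦ Bundle.TotalSpace.mk' (Model m →L[ℝ] Model m →L[ℝ] ℝ)
      (E := fun p : M ↦ Tan m p →L[ℝ] Tan m p →L[ℝ] ℝ) p (form p))

/-- An affine connection on a manifold (`cov Y x v` is `∇_v Y` at `x`). -/
abbrev AffineConnection (m : ℕ) (M : Type*) [TopologicalSpace M] [ChartedSpace (Model m) M]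
    [IsManifold (𝓡 m) ∞ M] :=
  CovariantDerivative (𝓡 m) (Model m) (TangentSpace (𝓡 m) : M → Type _)

/-- `cov` is the Levi-Civita connection of `g`: it is metric and torsion-free. -/
structure IsLeviCivita {m : ℕ} {M : Type*} [TopologicalSpace M] [ChartedSpace (Model m) M]
    [IsManifold (𝓡 m) ∞ M] (g : LorentzMetric m M)
    (cov : AffineConnection m M) : Prop where
  metric (p : M) (u : Tan m p) (Y Z : Π q : M, Tan m q)
    (hY : MDifferentiableAt (𝓡 m) ((𝓡 m).prod 𝓘(ℝ, Model m))
      (fun q ↦ Bundle.TotalSpace.mk' (Model m) q (Y q)) p)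
    (hZ : MDifferentiableAt (𝓡 m) ((𝓡 m).prod 𝓘(ℝ, Model m))
      (fun q ↦ Bundle.TotalSpace.mk' (Model m) q (Z q)) p) :
    mvfderiv (𝓡 m) (fun q ↦ g.form q (Y q) (Z q)) p u =
      g.form p (cov Y p u) (Z p) + g.form p (Y p) (cov Z p u)
  torsion : cov.torsion = 0

/-- The connection induced by `cov` on the pull-back bundle `f^* TM'`: the derivative at `x` in
direction `v` of a vector field `Z` along `f : M → M'`. If `s₁, …, s_k` is the local frame of `TM'`
given by the chart at `f x` and `Z = ∑ zʲ (sⱼ ∘ f)`, this is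
`∑ dzʲ(v) sⱼ + ∑ zʲ(x) ∇_{df v} sⱼ`. -/
def covAlong {k m : ℕ} {M M' : Type*} [TopologicalSpace M] [ChartedSpace (Model k) M]
    [TopologicalSpace M'] [ChartedSpace (Model m) M'] [IsManifold (𝓡 m) ∞ M']
    (cov : AffineConnection m M') (f : M → M') (Z : Π x : M, Tan m (f x)) (x : M) (v : Tan k x) :
    Tan m (f x) :=
  (trivializationAt (Model m) (TangentSpace (𝓡 m) : M' → Type _) (f x)).symm (f x)
      (mvfderiv (𝓡 k) (fun y ↦
        (trivializationAt (Model m) (TangentSpace (𝓡 m) : M' → Type _) (f x)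
          ⟨f y, Z y⟩).2) x v) +
    cov (FiberBundle.extend (Model m) (Z x)) (f x) (mfderiv (𝓡 k) (𝓡 m) f x v)

theorem LorentzMetric.eq_zero_of_forall {m : ℕ} {M : Type*} [TopologicalSpace M]
    [ChartedSpace (Model m) M] [IsManifold (𝓡 m) ∞ M] (g : LorentzMetric m M) (p : M)
    (u : Tan m p) (h : ∀ v, g.form p u v = 0) : u = 0 := by
  obtain ⟨t, -, ht⟩ := g.signature p
  by_contra hu
  have h1 := ht u (by rw [g.symm, h t]) hu
  rw [h u] at h1
  exact lt_irrefl _ h1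

section Induced

variable {k m : ℕ} {M M' : Type*} [TopologicalSpace M] [ChartedSpace (Model k) M]
  [TopologicalSpace M'] [ChartedSpace (Model m) M'] [IsManifold (𝓡 m) ∞ M']

/-- The (possibly degenerate) metric `f^* g` induced on `M` by `f : M → M'`. -/
def inducedMetric (g : LorentzMetric m M') (f : M → M') (x : M) (v w : Tan k x) : ℝ :=
  g.form (f x) (mfderiv (𝓡 k) (𝓡 m) f x v) (mfderiv (𝓡 k) (𝓡 m) f x w)

/-- The radical `RadTM = TM ∩ TM^⊥` of the induced metric at `x`. -/
def radical (g : LorentzMetric m M') (f : M → M') (x : M) : Submodule ℝ (Tan k x) where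
  carrier := {v | ∀ w, inducedMetric g f x v w = 0}
  zero_mem' := fun w ↦ by simp [inducedMetric]
  add_mem' := fun {a b} ha hb w ↦ by
    have h1 := ha w
    have h2 := hb w
    simp only [inducedMetric] at h1 h2
    simp [inducedMetric, h1, h2]
  smul_mem' := fun c a ha w ↦ by
    have h1 := ha w
    simp only [inducedMetric] at h1
    simp [inducedMetric, h1]

end Induced

/-- A lightlike hypersurface `M`, immersed by `imm` in the `(n+2)`-dimensional Lorentzian manifold
`(M', g)`, with a globally defined nowhere zero smooth null vector field `ξ` in its radical
distribution, and with a chosen screen distribution, that is, a smooth distribution of rank `n`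
complementary to the radical distribution in the tangent bundle of `M`. -/
structure Hypersurface (n : ℕ) {M' : Type*} [TopologicalSpace M'] [ChartedSpace (Model (n + 2)) M']
    [IsManifold (𝓡 (n + 2)) ∞ M'] (g : LorentzMetric (n + 2) M')
    (M : Type*) [TopologicalSpace M] [ChartedSpace (Model (n + 1)) M]
    [IsManifold (𝓡 (n + 1)) ∞ M] where
  imm : M → M'
  smooth_imm : ContMDiff (𝓡 (n + 1)) (𝓡 (n + 2)) ∞ imm
  injective_mfderiv (x : M) : Function.Injective (mfderiv (𝓡 (n + 1)) (𝓡 (n + 2)) imm x)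
  ξ : Π x : M, Tan (n + 1) x
  smooth_ξ : IsSmoothField ξ
  ξ_ne_zero (x : M) : ξ x ≠ 0
  ξ_mem_radical (x : M) : ξ x ∈ radical g imm x
  screen : Π x : M, Submodule ℝ (Tan (n + 1) x)
  smooth_screen : IsSmoothDistribution n screen
  isCompl_screen (x : M) : IsCompl (screen x) (radical g imm x)

namespace Hypersurface

variable {n : ℕ} {M' : Type*} [TopologicalSpace M'] [ChartedSpace (Model (n + 2)) M']
  [IsManifold (𝓡 (n + 2)) ∞ M'] {g : LorentzMetric (n + 2) M'}
  {M : Type*} [TopologicalSpace M] [ChartedSpace (Model (n + 1)) M]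
  [IsManifold (𝓡 (n + 1)) ∞ M] (L : Hypersurface n g M)

/-- The differential of the immersion, as a map into the tangent space of the ambient manifold. -/
def d (x : M) : Tan (n + 1) x →L[ℝ] Tan (n + 2) (L.imm x) :=
  mfderiv (𝓡 (n + 1)) (𝓡 (n + 2)) L.imm x

theorem d_injective (x : M) : Function.Injective (L.d x) := L.injective_mfderiv x

/-- The induced degenerate metric on `M`. -/
def metric (x : M) : LinearMap.BilinForm ℝ (Tan (n + 1) x) :=
  LinearMap.mk₂ ℝ (fun v w ↦ g.form (L.imm x) (L.d x v) (L.d x w))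
    (by simp) (by simp) (by simp) (by simp)

@[simp] theorem metric_apply (x : M) (v w : Tan (n + 1) x) :
    L.metric x v w = g.form (L.imm x) (L.d x v) (L.d x w) := rfl

/-- The radical distribution `RadTM`. -/
def rad (x : M) : Submodule ℝ (Tan (n + 1) x) := radical g L.imm x

theorem mem_rad {x : M} {v : Tan (n + 1) x} : v ∈ L.rad x ↔ ∀ w, L.metric x v w = 0 := Iff.rfl

theorem ξ_mem_rad (x : M) : L.ξ x ∈ L.rad x := L.ξ_mem_radical x

theorem isCompl (x : M) : IsCompl (L.screen x) (L.rad x) := L.isCompl_screen x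

theorem form_ξ (x : M) (w : Tan (n + 1) x) :
    g.form (L.imm x) (L.d x (L.ξ x)) (L.d x w) = 0 := L.ξ_mem_rad x w

/-- `TM^⊥` is spanned by `ξ`. -/
theorem exists_smul_of_perp (x : M) (V : Tan (n + 2) (L.imm x))
    (hV : ∀ w, g.form (L.imm x) V (L.d x w) = 0) : ∃ c : ℝ, V = c • L.d x (L.ξ x) := by
  let p := L.imm x
  let B : LinearMap.BilinForm ℝ (Tan (n + 2) p) :=
    LinearMap.mk₂ ℝ (fun u v ↦ g.form p u v) (by simp) (by simp) (by simp) (by simp)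
  have hnd : B.Nondegenerate := by
    refine ⟨fun u h ↦ g.eq_zero_of_forall p u h, fun u h ↦ g.eq_zero_of_forall p u fun v ↦ ?_⟩
    rw [g.symm]
    exact h v
  let H : Submodule ℝ (Tan (n + 2) p) :=
    LinearMap.range (L.d x : Tan (n + 1) x →ₗ[ℝ] Tan (n + 2) p)
  have hH : Module.finrank ℝ H = n + 1 := by
    have h := LinearMap.finrank_range_of_inj (f := (L.d x : Tan (n + 1) x →ₗ[ℝ] Tan (n + 2) p))
      (L.d_injective x)
    rw [finrank_tan] at h
    exact h
  have hO : Module.finrank ℝ (B.orthogonal H) = 1 := by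
    rw [LinearMap.BilinForm.finrank_orthogonal hnd, hH, finrank_tan]
    omega
  have mem : ∀ W : Tan (n + 2) p, (∀ w, g.form p W (L.d x w) = 0) → W ∈ B.orthogonal H := by
    rintro W hW _ ⟨w, rfl⟩
    change g.form p (L.d x w) W = 0
    rw [g.symm]
    exact hW w
  have hne : L.d x (L.ξ x) ≠ 0 := by
    intro h
    exact L.ξ_ne_zero x (L.d_injective x (by rw [h, map_zero]))
  obtain ⟨c, hc⟩ := (finrank_eq_one_iff_of_nonzero'
    (⟨L.d x (L.ξ x), mem _ (L.form_ξ x)⟩ : B.orthogonal H)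
    (fun h ↦ hne (congrArg Subtype.val h))).1 hO ⟨V, mem V hV⟩
  exact ⟨c, (congrArg Subtype.val hc).symm⟩

theorem exists_smul_of_mem_rad {x : M} {v : Tan (n + 1) x} (hv : v ∈ L.rad x) :
    ∃ c : ℝ, v = c • L.ξ x := by
  obtain ⟨c, hc⟩ := L.exists_smul_of_perp x (L.d x v) hv
  exact ⟨c, L.d_injective x (by rw [hc, map_smul])⟩

/-- Existence and uniqueness of the null transversal vector associated with the screen. -/
theorem existsUnique_transversal (x : M) : ∃! N : Tan (n + 2) (L.imm x),
    g.form (L.imm x) N (L.d x (L.ξ x)) = 1 ∧ g.form (L.imm x) N N = 0 ∧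
      ∀ w ∈ L.screen x, g.form (L.imm x) N (L.d x w) = 0 := by
  have hne : L.d x (L.ξ x) ≠ 0 := fun h ↦
    L.ξ_ne_zero x (L.d_injective x (by rw [h, map_zero]))
  -- a left inverse of the differential
  obtain ⟨r, hr⟩ := LinearMap.exists_leftInverse_of_injective
    (L.d x : Tan (n + 1) x →ₗ[ℝ] Tan (n + 2) (L.imm x)) (LinearMap.ker_eq_bot.2 (L.d_injective x))
  have hr' (w) : r (L.d x w) = w := LinearMap.congr_fun hr w
  -- a functional on the tangent space of `M` which vanishes on the screen and is `1` at `ξ`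
  have hξ : L.ξ x ∉ L.screen x := fun h ↦ L.ξ_ne_zero x
    ((Submodule.disjoint_def.1 (L.isCompl x).disjoint) _ h (L.ξ_mem_rad x))
  obtain ⟨φ, hφ1, hφ0⟩ := Submodule.exists_le_ker_of_notMem hξ
  let ψ : Module.Dual ℝ (Tan (n + 2) (L.imm x)) := (φ (L.ξ x))⁻¹ • (φ ∘ₗ r)
  let B : Tan (n + 2) (L.imm x) →ₗ[ℝ] Module.Dual ℝ (Tan (n + 2) (L.imm x)) :=
    LinearMap.mk₂ ℝ (fun u v ↦ g.form (L.imm x) u v) (by simp) (by simp) (by simp) (by simp)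
  have hB : Function.Injective B := by
    rw [← LinearMap.ker_eq_bot, LinearMap.ker_eq_bot']
    intro u hu
    exact g.eq_zero_of_forall _ u fun v ↦ LinearMap.congr_fun hu v
  obtain ⟨V, hV⟩ := (LinearMap.injective_iff_surjective_of_finrank_eq_finrank
    Subspace.dual_finrank_eq.symm).1 hB ψ
  have hV' (u) : g.form (L.imm x) V u = ψ u := LinearMap.congr_fun hV u
  have hV1 : g.form (L.imm x) V (L.d x (L.ξ x)) = 1 := by
    rw [hV']
    simp [ψ, hr', hφ1]
  have hV0 : ∀ w ∈ L.screen x, g.form (L.imm x) V (L.d x w) = 0 := by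
    intro w hw
    have hw' : φ w = 0 := hφ0 hw
    rw [hV']
    simp [ψ, hr', hw']
  have hV1' : g.form (L.imm x) (L.d x (L.ξ x)) V = 1 := by rw [g.symm, hV1]
  refine ⟨V - (g.form (L.imm x) V V / 2) • L.d x (L.ξ x), ⟨?_, ?_, ?_⟩, ?_⟩
  · simp [hV1, L.form_ξ]
  · simp [hV1, hV1', L.form_ξ]
    ring
  · intro w hw
    simp [hV0 w hw, L.form_ξ]
  · rintro N ⟨hN1, hN2, hN0⟩
    obtain ⟨c, hc⟩ := L.exists_smul_of_perp x (N - V) fun w ↦ by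
      obtain ⟨a, ha, b, hb, rfl⟩ := Submodule.mem_sup.1
        ((L.isCompl x).sup_eq_top ▸ Submodule.mem_top : w ∈ L.screen x ⊔ L.rad x)
      obtain ⟨k, rfl⟩ := L.exists_smul_of_mem_rad hb
      simp [hN1, hV1, hN0 a ha, hV0 a ha]
    have hN : N = V + c • L.d x (L.ξ x) := by rw [← hc]; abel
    have h := hN2
    rw [hN] at h
    simp [hV1, hV1', L.form_ξ] at h
    have hc' : c = -(g.form (L.imm x) V V / 2) := by linarith
    rw [hN, hc', neg_smul, sub_eq_add_neg]

/-- The null transversal vector field `N` along `M`, determined by `g(N, ξ) = 1`, `g(N, N) = 0` and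
`g(N, W) = 0` for `W` in the screen distribution. -/
def N (x : M) : Tan (n + 2) (L.imm x) := (L.existsUnique_transversal x).choose

theorem N_spec (x : M) : g.form (L.imm x) (L.N x) (L.d x (L.ξ x)) = 1 ∧
    g.form (L.imm x) (L.N x) (L.N x) = 0 ∧
      ∀ w ∈ L.screen x, g.form (L.imm x) (L.N x) (L.d x w) = 0 :=
  (L.existsUnique_transversal x).choose_spec.1

/-- The tangent space of `M` inside the ambient tangent space. -/
def tangent (x : M) : Submodule ℝ (Tan (n + 2) (L.imm x)) :=
  LinearMap.range (L.d x : Tan (n + 1) x →ₗ[ℝ] Tan (n + 2) (L.imm x))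

/-- The lightlike transversal bundle `tr(TM)`. -/
def tr (x : M) : Submodule ℝ (Tan (n + 2) (L.imm x)) := Submodule.span ℝ {L.N x}

/-- The decomposition `TM'|_M = TM ⊕ tr(TM)`. -/
theorem isCompl_tangent_tr (x : M) : IsCompl (L.tangent x) (L.tr x) := by
  have hd : Disjoint (L.tangent x) (L.tr x) := by
    rw [Submodule.disjoint_def]
    rintro _ ⟨w, rfl⟩ hw
    obtain ⟨c, hc⟩ := Submodule.mem_span_singleton.1 hw
    have h : g.form (L.imm x) (c • L.N x) (L.d x (L.ξ x)) = 0 := by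
      rw [hc, g.symm]
      exact L.form_ξ x w
    have h0 : c = 0 := by simpa [(L.N_spec x).1] using h
    rw [← hc, h0, zero_smul]
  refine (Submodule.isCompl_iff_disjoint _ _ ?_).2 hd
  have hN : L.N x ≠ 0 := by
    intro h
    have h1 := (L.N_spec x).1
    rw [h] at h1
    simp at h1
  have h1 : Module.finrank ℝ (L.tangent x) = n + 1 := by
    have h := LinearMap.finrank_range_of_inj
      (f := (L.d x : Tan (n + 1) x →ₗ[ℝ] Tan (n + 2) (L.imm x))) (L.d_injective x)
    rw [finrank_tan] at h
    exact h
  have h2 : Module.finrank ℝ (L.tr x) = 1 := finrank_span_singleton hN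
  rw [h1, h2, finrank_tan]

/-- The projection `Q` of the ambient tangent space onto the tangent space of `M` along
`tr(TM)`. -/
def Q (x : M) : Tan (n + 2) (L.imm x) →ₗ[ℝ] Tan (n + 1) x :=
  (LinearEquiv.ofInjective (L.d x : Tan (n + 1) x →ₗ[ℝ] Tan (n + 2) (L.imm x))
      (L.d_injective x)).symm.toLinearMap ∘ₗ
    Submodule.projectionOnto (L.tangent x) (L.tr x) (L.isCompl_tangent_tr x)

/-- The projection `P` of the tangent space of `M` onto the screen along `RadTM`. -/
def P (x : M) : Tan (n + 1) x →ₗ[ℝ] Tan (n + 1) x :=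
  Submodule.projection (L.screen x) (L.rad x) (L.isCompl x)

/-- The one-form `η = g(N, ·)`. -/
def η (x : M) : Tan (n + 1) x →L[ℝ] ℝ := (g.form (L.imm x) (L.N x)).comp (L.d x)

/-- The duality map `♭`: `X^♭ = g(X, ·) + η(X) η`. -/
def flat (x : M) : Tan (n + 1) x →ₗ[ℝ] Module.Dual ℝ (Tan (n + 1) x) :=
  LinearMap.mk₂ ℝ (fun v w ↦ L.metric x v w + L.η x v * L.η x w)
    (fun a b c ↦ by simp; ring) (fun a b c ↦ by simp; ring)
    (fun a b c ↦ by simp; ring) (fun a b c ↦ by simp; ring)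

theorem flat_apply (x : M) (v w : Tan (n + 1) x) :
    L.flat x v w = L.metric x v w + L.η x v * L.η x w := rfl

theorem flat_injective (x : M) : Function.Injective (L.flat x) := by
  rw [← LinearMap.ker_eq_bot, LinearMap.ker_eq_bot']
  intro v hv
  have h (w) : L.metric x v w + L.η x v * L.η x w = 0 := by
    rw [← L.flat_apply, hv]; rfl
  have hξ : L.η x (L.ξ x) = 1 := (L.N_spec x).1
  have h0 : L.η x v = 0 := by
    have h1 := h (L.ξ x)
    have h2 : L.metric x v (L.ξ x) = 0 := by
      rw [L.metric_apply, g.symm]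
      exact L.form_ξ x v
    rw [h2, hξ] at h1
    linarith
  obtain ⟨c, rfl⟩ := L.exists_smul_of_mem_rad (v := v) (L.mem_rad.2 fun w ↦ by
    have h1 := h w
    rw [h0] at h1
    linarith)
  rw [map_smul, hξ, smul_eq_mul, mul_one] at h0
  rw [h0, zero_smul]

/-- The isomorphism `♭` from vectors to covectors; its inverse is `♯`. -/
def flatEquiv (x : M) : Tan (n + 1) x ≃ₗ[ℝ] Module.Dual ℝ (Tan (n + 1) x) :=
  LinearEquiv.ofInjectiveOfFinrankEq (L.flat x) (L.flat_injective x) Subspace.dual_finrank_eq.symm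

/-- The gradient `∇^g f = (df)^♯`, that is, `(∇^g f)^♭ = df`. -/
def gradient (f : M → ℝ) (x : M) : Tan (n + 1) x :=
  (L.flatEquiv x).symm (mvfderiv (𝓡 (n + 1)) f x : Tan (n + 1) x →ₗ[ℝ] ℝ)

variable (cov : AffineConnection (n + 2) M')

/-- `∇̄_v Y` at `x` for the ambient connection `∇̄`, a vector field `Y` on `M` and `v ∈ T_x M`. -/
def ambientDeriv (Y : Π x : M, Tan (n + 1) x) (x : M) (v : Tan (n + 1) x) :
    Tan (n + 2) (L.imm x) :=
  covAlong cov L.imm (fun y ↦ L.d y (Y y)) x v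

/-- The induced connection: `inducedDeriv cov Y x v` is `∇_v Y = Q (∇̄_v Y)` at `x`. -/
def inducedDeriv (Y : Π x : M, Tan (n + 1) x) (x : M) (v : Tan (n + 1) x) : Tan (n + 1) x :=
  L.Q x (L.ambientDeriv cov Y x v)

/-- The second fundamental form `h(X, Y) = ∇̄_X Y - ∇_X Y` of `M`. -/
def secondFundamentalForm (X Y : Π x : M, Tan (n + 1) x) (x : M) : Tan (n + 2) (L.imm x) :=
  L.ambientDeriv cov Y x (X x) - L.d x (L.inducedDeriv cov Y x (X x))

/-- `M` is totally geodesic: `h = 0`. -/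
def IsTotallyGeodesic : Prop :=
  ∀ X Y : Π x : M, Tan (n + 1) x, IsSmoothField X → IsSmoothField Y →
    ∀ x, L.secondFundamentalForm cov X Y x = 0

/-- The second fundamental form `h*(X, Y)` of the screen distribution, for a section `Y` of it:
the component of `∇_X Y` in `RadTM`. -/
def screenSecondFundamentalForm (X Y : Π x : M, Tan (n + 1) x) (x : M) : Tan (n + 1) x :=
  L.inducedDeriv cov Y x (X x) - L.P x (L.inducedDeriv cov Y x (X x))

/-- The screen distribution is totally geodesic: `h* = 0`. -/
def IsScreenTotallyGeodesic : Prop :=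
  ∀ X Y : Π x : M, Tan (n + 1) x, IsSmoothField X → IsSmoothSectionOf L.screen Y →
    ∀ x, L.screenSecondFundamentalForm cov X Y x = 0

/-- `∇S(X, Y) = (∇_X S) Y = ∇_X (S Y) - S (∇_X Y)`. -/
def nablaTensor (S : Π x : M, Tan (n + 1) x →L[ℝ] Tan (n + 1) x) (X Y : Π x : M, Tan (n + 1) x)
    (x : M) : Tan (n + 1) x :=
  L.inducedDeriv cov (fun y ↦ S y (Y y)) x (X x) - S x (L.inducedDeriv cov Y x (X x))

/-- `S` is an `A^∇`-tensor: a smooth, screen preserving, `g`-symmetric field of endomorphisms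
with `X^♭ (∇S(X, X)) = 0` for all `X`. -/
structure IsATensor (S : Π x : M, Tan (n + 1) x →L[ℝ] Tan (n + 1) x) : Prop where
  smooth : IsSmoothEndomorphism S
  screen_preserving (x : M) (v : Tan (n + 1) x) : L.P x (S x v) = S x (L.P x v)
  symmetric (x : M) (v w : Tan (n + 1) x) : L.metric x (S x v) w = L.metric x v (S x w)
  killing (X : Π x : M, Tan (n + 1) x) (hX : IsSmoothField X) (x : M) :
    L.flat x (X x) (L.nablaTensor cov S X X x) = 0

/-- `S` has exactly three eigenfunctions `lam`, `α`, `β`: these are smooth functions with pairwise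
distinct values at each point, whose values at each point are exactly the eigenvalues of `S`, and
the eigenspace of `lam` is `RadTM`. -/
structure HasExactlyThreeEigenfunctions (S : Π x : M, Tan (n + 1) x →L[ℝ] Tan (n + 1) x)
    (lam α β : M → ℝ) : Prop where
  smooth_lam : ContMDiff (𝓡 (n + 1)) 𝓘(ℝ, ℝ) ∞ lam
  smooth_α : ContMDiff (𝓡 (n + 1)) 𝓘(ℝ, ℝ) ∞ α
  smooth_β : ContMDiff (𝓡 (n + 1)) 𝓘(ℝ, ℝ) ∞ β
  lam_ne_α (x : M) : lam x ≠ α x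
  lam_ne_β (x : M) : lam x ≠ β x
  α_ne_β (x : M) : α x ≠ β x
  hasEigenvalue_iff (x : M) (c : ℝ) :
    Module.End.HasEigenvalue (S x : Tan (n + 1) x →ₗ[ℝ] Tan (n + 1) x) c ↔
      c = lam x ∨ c = α x ∨ c = β x
  eigenspace_lam (x : M) : eigenDistribution S lam x = L.rad x

end Hypersurface

end Lightlike

end

/-!
For a totally geodesic lightlike hypersurface the induced connection `∇` agrees with the ambient
Levi-Civita connection, so it is torsion-free (`inducedDeriv_sub_inducedDeriv`) and metric for the
degenerate metric (`mvfderiv_metric`). Both facts come from the corresponding ones for the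
connection along a map, proved in the coordinates of a chart.

The tensor `S` is symmetric for the positive definite form associated with `♭`, hence
diagonalizable, and the screen is the orthogonal sum of `D_α` and `D_β`. Polynomials in `S` project
vector fields onto the eigendistributions (`eigenPart`), so every eigenvector extends to a global
section.

*Gradients.* For a section `X` of `D_α` the tensor condition reads `dα(X) g(X, X) = 0`, so `dα`
vanishes on `D_α`, and `dβ` on `D_β` (`mvfderiv_eq_zero_of_mem`). As the trace is constant, the
multiplicities `p`, `q` of `α`, `β` are locally constant and `p dα + q dβ = 0`
(`exists_mvfderiv_relation`); so `dα` and `dβ` vanish on the whole screen, and the gradients are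
radical.

*Integrability.* Let `X`, `W` be sections of `D_α`, `D_β`. Since `dα` and `dβ` vanish on the screen,
the tensor condition for `X + W` reads `g(∇_{X+W} X, W) = 0`, as the connection is metric. Comparing
its parts linear and quadratic in `W` gives `g(∇_X X, W) = 0`, so `∇_X Z + ∇_Z X` is orthogonal to
`D_β` for sections `X`, `Z` of `D_α`. If `D_α` is integrable then `∇_X Z` itself is orthogonal to
`D_β` (`metric_inducedDeriv`). With the symmetric statement for `D_β`, and the screen being totally
geodesic, the derivatives of sections of `D_α` along the screen stay in `D_α`, which says that `∇S`
vanishes on the screen (`nablaTensor_eq_zero_of_section`). Conversely `∇S = 0` on the screen gives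
`∇_X Y ∈ D_α` for sections of `D_α`, hence `[X, Y] ∈ D_α`.
-/

open scoped Manifold ContDiff Topology

open Bundle

noncomputable section

namespace Lightlike

/-! ### Lie brackets acting on vector-valued functions -/

section Bracket

variable {k : ℕ} {M : Type*} [TopologicalSpace M] [ChartedSpace (Model k) M]
  {V : Type*} [NormedAddCommGroup V] [NormedSpace ℝ V]

theorem contDiffAt_comp_extChartAt_symm {x : M} {F : M → V}
    (hF : ContMDiffAt (𝓡 k) 𝓘(ℝ, V) ∞ F x) :
    ContDiffAt ℝ ∞ (F ∘ (extChartAt (𝓡 k) x).symm) (extChartAt (𝓡 k) x x) := by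
  have h := (contMDiffAt_iff.1 hF).2
  rw [ModelWithCorners.range_eq_univ, contDiffWithinAt_univ] at h
  exact h

theorem differentiableAt_fderiv_comp_extChartAt_symm {x : M} {F : M → V}
    (hF : ContMDiffAt (𝓡 k) 𝓘(ℝ, V) ∞ F x) :
    DifferentiableAt ℝ (fderiv ℝ (F ∘ (extChartAt (𝓡 k) x).symm)) (extChartAt (𝓡 k) x x) :=
  ((contDiffAt_comp_extChartAt_symm hF).fderiv_right (m := 1)
    (WithTop.coe_le_coe.2 le_top)).differentiableAt one_ne_zero

variable [IsManifold (𝓡 k) ∞ M]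

/-- The expression of a vector field in the chart at `x`. -/
def chartField (x : M) (X : Π y : M, Tan k y) : Model k → Model k :=
  VectorField.mpullbackWithin 𝓘(ℝ, Model k) (𝓡 k) (extChartAt (𝓡 k) x).symm X (Set.range (𝓡 k))

theorem differentiableAt_chartField {x : M} {X : Π y : M, Tan k y}
    (hX : MDifferentiableAt (𝓡 k) ((𝓡 k).prod 𝓘(ℝ, Model k))
      (fun y ↦ TotalSpace.mk' (Model k) y (X y)) x) :
    DifferentiableAt ℝ (chartField x X) (extChartAt (𝓡 k) x x) := by
  have h := (mdifferentiableWithinAt_univ.2 hX).differentiableWithinAt_mpullbackWithin_vectorField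
  exact h.differentiableAt (by simp)

theorem fderiv_comp_extChartAt_symm_chartField {x : M} (X : Π y : M, Tan k y) {F : M → V}
    {u : Model k} (hu : u ∈ (extChartAt (𝓡 k) x).target)
    (hF : MDifferentiableAt (𝓡 k) 𝓘(ℝ, V) F ((extChartAt (𝓡 k) x).symm u)) :
    fderiv ℝ (F ∘ (extChartAt (𝓡 k) x).symm) u (chartField x X u) =
      mvfderiv (𝓡 k) F ((extChartAt (𝓡 k) x).symm u) (X ((extChartAt (𝓡 k) x).symm u)) := by
  have hφ := mdifferentiableWithinAt_extChartAt_symm (I := 𝓡 k) hu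
  have hinv := isInvertible_mfderivWithin_extChartAt_symm (I := 𝓡 k) hu
  rw [show Set.range (𝓡 k) = Set.univ from ModelWithCorners.range_eq_univ _,
    mdifferentiableWithinAt_univ] at hφ
  have hc := mfderiv_comp u hF hφ
  rw [mfderiv_eq_fderiv] at hc
  rw [hc]
  change mfderiv (𝓡 k) 𝓘(ℝ, V) F _ (mfderiv 𝓘(ℝ, Model k) (𝓡 k) (extChartAt (𝓡 k) x).symm u
    ((mfderivWithin 𝓘(ℝ, Model k) (𝓡 k) (extChartAt (𝓡 k) x).symm (Set.range (𝓡 k)) u).inverse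
      (X ((extChartAt (𝓡 k) x).symm u)))) = _
  rw [← mfderivWithin_univ (f := (extChartAt (𝓡 k) x).symm), ← ModelWithCorners.range_eq_univ (𝓡 k),
    hinv.self_apply_inverse]
  rfl

/-- In the chart at `x`, the function `Y F` is `u ↦ D(F ∘ φ⁻¹)(u) (Ỹ u)`. -/
theorem eventuallyEq_fderiv_chartField {x : M} (Y : Π y : M, Tan k y) {F : M → V}
    (hF : ContMDiffAt (𝓡 k) 𝓘(ℝ, V) ∞ F x) :
    (fun y ↦ mvfderiv (𝓡 k) F y (Y y)) ∘ (extChartAt (𝓡 k) x).symm =ᶠ[𝓝 (extChartAt (𝓡 k) x x)]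
      fun u ↦ fderiv ℝ (F ∘ (extChartAt (𝓡 k) x).symm) u (chartField x Y u) := by
  have h1 : ∀ᶠ y in 𝓝 x, MDifferentiableAt (𝓡 k) 𝓘(ℝ, V) F y := by
    filter_upwards [(contMDiffAt_iff_contMDiffAt_nhds (by simp)).1
      (hF.of_le (m := 1) (WithTop.coe_le_coe.2 le_top))] with y hy
      using hy.mdifferentiableAt one_ne_zero
  have hc : Filter.Tendsto (extChartAt (𝓡 k) x).symm (𝓝 (extChartAt (𝓡 k) x x)) (𝓝 x) := by
    have := (continuousAt_extChartAt_symm (I := 𝓡 k) x).tendsto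
    rwa [extChartAt_to_inv] at this
  filter_upwards [hc.eventually h1, extChartAt_target_mem_nhds (I := 𝓡 k) x] with u hu hu'
  exact (fderiv_comp_extChartAt_symm_chartField Y hu' hu).symm

theorem mdifferentiableAt_mvfderiv_apply {x : M} {Y : Π y : M, Tan k y} {F : M → V}
    (hF : ContMDiffAt (𝓡 k) 𝓘(ℝ, V) ∞ F x)
    (hY : MDifferentiableAt (𝓡 k) ((𝓡 k).prod 𝓘(ℝ, Model k))
      (fun y ↦ TotalSpace.mk' (Model k) y (Y y)) x) :
    MDifferentiableAt (𝓡 k) 𝓘(ℝ, V) (fun y ↦ mvfderiv (𝓡 k) F y (Y y)) x := by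
  have h : DifferentiableAt ℝ ((fun y ↦ mvfderiv (𝓡 k) F y (Y y)) ∘ (extChartAt (𝓡 k) x).symm)
      (extChartAt (𝓡 k) x x) :=
    (DifferentiableAt.clm_apply (differentiableAt_fderiv_comp_extChartAt_symm hF)
      (differentiableAt_chartField hY)).congr_of_eventuallyEq (eventuallyEq_fderiv_chartField Y hF)
  refine (h.mdifferentiableAt.comp x (mdifferentiableAt_extChartAt (I := 𝓡 k)
    (mem_chart_source _ x))).congr_of_eventuallyEq ?_
  filter_upwards [extChartAt_source_mem_nhds (I := 𝓡 k) x] with y hy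
  simp only [Function.comp_apply]
  rw [(extChartAt (𝓡 k) x).left_inv hy]

/-- A vector field acts on vector-valued functions as a derivation, and the Lie bracket of two
fields acts as their commutator. -/
theorem mvfderiv_mlieBracket {x : M} {X Y : Π y : M, Tan k y} {F : M → V}
    (hF : ContMDiffAt (𝓡 k) 𝓘(ℝ, V) ∞ F x)
    (hX : MDifferentiableAt (𝓡 k) ((𝓡 k).prod 𝓘(ℝ, Model k))
      (fun y ↦ TotalSpace.mk' (Model k) y (X y)) x)
    (hY : MDifferentiableAt (𝓡 k) ((𝓡 k).prod 𝓘(ℝ, Model k))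
      (fun y ↦ TotalSpace.mk' (Model k) y (Y y)) x) :
    mvfderiv (𝓡 k) F x (VectorField.mlieBracket (𝓡 k) X Y x) =
      mvfderiv (𝓡 k) (fun y ↦ mvfderiv (𝓡 k) F y (Y y)) x (X x) -
        mvfderiv (𝓡 k) (fun y ↦ mvfderiv (𝓡 k) F y (X y)) x (Y x) := by
  set φ := extChartAt (𝓡 k) x with hφ
  set G : Model k → V := F ∘ φ.symm with hG
  have hx : φ.symm (φ x) = x := extChartAt_to_inv x
  have hFx : MDifferentiableAt (𝓡 k) 𝓘(ℝ, V) F x := hF.mdifferentiableAt (by simp)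
  -- the second derivative of `F ∘ φ⁻¹` along two fields
  have key (Z W : Π y : M, Tan k y)
      (hW : MDifferentiableAt (𝓡 k) ((𝓡 k).prod 𝓘(ℝ, Model k))
        (fun y ↦ TotalSpace.mk' (Model k) y (W y)) x) :
      mvfderiv (𝓡 k) (fun y ↦ mvfderiv (𝓡 k) F y (W y)) x (Z x) =
        fderiv ℝ (fderiv ℝ G) (φ x) (chartField x Z (φ x)) (chartField x W (φ x)) +
          fderiv ℝ G (φ x) (fderiv ℝ (chartField x W) (φ x) (chartField x Z (φ x))) := by
    have h := fderiv_comp_extChartAt_symm_chartField (x := x) (u := φ x) Z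
      (F := fun y ↦ mvfderiv (𝓡 k) F y (W y)) (mem_extChartAt_target x)
      (by rw [← hφ, hx]; exact mdifferentiableAt_mvfderiv_apply hF hW)
    rw [(eventuallyEq_fderiv_chartField W hF).fderiv_eq,
      fderiv_clm_apply (differentiableAt_fderiv_comp_extChartAt_symm hF)
        (differentiableAt_chartField hW)] at h
    rw [← hφ, hx] at h
    rw [← h, add_comm]
    rfl
  have hsymm : IsSymmSndFDerivAt ℝ G (φ x) :=
    (contDiffAt_comp_extChartAt_symm hF).isSymmSndFDerivAt (by
      rw [minSmoothness_of_isRCLikeNormedField]; exact WithTop.coe_le_coe.2 le_top)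
  have hinv : (mfderiv (𝓡 k) 𝓘(ℝ, Model k) φ x).IsInvertible :=
    isInvertible_mfderiv_extChartAt (mem_extChartAt_source x)
  have hFφ : F =ᶠ[𝓝 x] G ∘ φ := by
    filter_upwards [extChartAt_source_mem_nhds (I := 𝓡 k) x] with y hy
    simp only [hG, Function.comp_apply]
    rw [φ.left_inv hy]
  have hGd : DifferentiableAt ℝ G (φ x) :=
    (contDiffAt_comp_extChartAt_symm hF).differentiableAt (by simp)
  have hL : mvfderiv (𝓡 k) F x (VectorField.mlieBracket (𝓡 k) X Y x) =
      fderiv ℝ G (φ x) (VectorField.lieBracket ℝ (chartField x X) (chartField x Y) (φ x)) := by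
    have h1 : mfderiv (𝓡 k) 𝓘(ℝ, V) F x =
        (fderiv ℝ G (φ x)).comp (mfderiv (𝓡 k) 𝓘(ℝ, Model k) φ x) := by
      rw [hFφ.mfderiv_eq, mfderiv_comp x hGd.mdifferentiableAt
        (mdifferentiableAt_extChartAt (I := 𝓡 k) (mem_chart_source _ x)), mfderiv_eq_fderiv]
      rfl
    have h2 : VectorField.lieBracketWithin ℝ (chartField x X) (chartField x Y)
        (φ.symm ⁻¹' Set.univ ∩ Set.range (𝓡 k)) (φ x) =
        VectorField.lieBracket ℝ (chartField x X) (chartField x Y) (φ x) := by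
      rw [Set.preimage_univ, Set.univ_inter, ModelWithCorners.range_eq_univ,
        VectorField.lieBracketWithin_univ]
    have h3 : VectorField.mlieBracket (𝓡 k) X Y x =
        (mfderiv (𝓡 k) 𝓘(ℝ, Model k) φ x).inverse
          (VectorField.lieBracket ℝ (chartField x X) (chartField x Y) (φ x) : Model k) :=
      congrArg (fun w : Model k ↦ (mfderiv (𝓡 k) 𝓘(ℝ, Model k) φ x).inverse w) h2
    change mfderiv (𝓡 k) 𝓘(ℝ, V) F x _ = _
    rw [h1, h3]
    change fderiv ℝ G (φ x) (mfderiv (𝓡 k) 𝓘(ℝ, Model k) φ x _) = _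
    exact congrArg (fun w : Model k ↦ fderiv ℝ G (φ x) w) (hinv.self_apply_inverse _)
  rw [hL, key X Y hY, key Y X hX, VectorField.lieBracket, map_sub,
    hsymm.eq (chartField x X (φ x)) (chartField x Y (φ x))]
  abel

end Bracket

/-! ### Metric connections along a map -/

section Calculus

variable {k : ℕ} {M : Type*} [TopologicalSpace M] [ChartedSpace (Model k) M]
  {A B C : Type*} [NormedAddCommGroup A] [NormedSpace ℝ A] [NormedAddCommGroup B] [NormedSpace ℝ B]
  [NormedAddCommGroup C] [NormedSpace ℝ C]

theorem differentiableAt_comp_extChartAt_symm {F : M → A} {x : M}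
    (hF : MDifferentiableAt (𝓡 k) 𝓘(ℝ, A) F x) :
    DifferentiableAt ℝ (F ∘ (extChartAt (𝓡 k) x).symm) (extChartAt (𝓡 k) x x) := by
  have h := ((mdifferentiableAt_iff _ _).1 hF).2
  rw [ModelWithCorners.range_eq_univ, differentiableWithinAt_univ] at h
  exact h

/-- In the chart at `x`, which identifies the tangent space at `x` with the model space, the
differential is the Fréchet derivative. -/
theorem mvfderiv_eq_fderiv_comp_extChartAt_symm {F : M → A} {x : M}
    (hF : MDifferentiableAt (𝓡 k) 𝓘(ℝ, A) F x) (v : Tan k x) :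
    mvfderiv (𝓡 k) F x v =
      fderiv ℝ (F ∘ (extChartAt (𝓡 k) x).symm) (extChartAt (𝓡 k) x x) v := by
  rw [← fderivWithin_univ, ← ModelWithCorners.range_eq_univ (𝓡 k)]
  exact congrArg (fun T : Tan k x →L[ℝ] A ↦ T v) hF.mfderiv

/-- The product rule for a bilinear expression with variable coefficients. -/
theorem mvfderiv_clm_apply₂ {G : M → A →L[ℝ] B →L[ℝ] C} {a : M → A} {b : M → B} {x : M}
    (hG : MDifferentiableAt (𝓡 k) 𝓘(ℝ, A →L[ℝ] B →L[ℝ] C) G x)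
    (ha : MDifferentiableAt (𝓡 k) 𝓘(ℝ, A) a x) (hb : MDifferentiableAt (𝓡 k) 𝓘(ℝ, B) b x)
    (v : Tan k x) :
    mvfderiv (𝓡 k) (fun y ↦ G y (a y) (b y)) x v =
      mvfderiv (𝓡 k) G x v (a x) (b x) + G x (mvfderiv (𝓡 k) a x v) (b x) +
        G x (a x) (mvfderiv (𝓡 k) b x v) := by
  have hx : (extChartAt (𝓡 k) x).symm (extChartAt (𝓡 k) x x) = x := extChartAt_to_inv x
  have hG' := differentiableAt_comp_extChartAt_symm hG
  have ha' := differentiableAt_comp_extChartAt_symm ha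
  have hb' := differentiableAt_comp_extChartAt_symm hb
  rw [mvfderiv_eq_fderiv_comp_extChartAt_symm ((hG.clm_apply ha).clm_apply hb),
    mvfderiv_eq_fderiv_comp_extChartAt_symm hG, mvfderiv_eq_fderiv_comp_extChartAt_symm ha,
    mvfderiv_eq_fderiv_comp_extChartAt_symm hb]
  have h (w : Model k) := congrArg (fun T : Model k →L[ℝ] C ↦ T w)
    (fderiv_clm_apply (hG'.clm_apply ha') hb')
  rw [fderiv_clm_apply hG' ha'] at h
  simp only [add_apply, ContinuousLinearMap.comp_apply, ContinuousLinearMap.flip_apply,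
    Function.comp_apply, hx] at h
  refine (h v).trans ?_
  abel

/-- The chain rule for a map into a normed space. -/
theorem mvfderiv_comp_mfderiv {m : ℕ} {M' : Type*} [TopologicalSpace M'] [ChartedSpace (Model m) M']
    {f : M → M'} {F : M' → A} {x : M} (hF : MDifferentiableAt (𝓡 m) 𝓘(ℝ, A) F (f x))
    (hf : MDifferentiableAt (𝓡 k) (𝓡 m) f x) (v : Tan k x) :
    mvfderiv (𝓡 k) (fun y ↦ F (f y)) x v =
      mvfderiv (𝓡 m) F (f x) (mfderiv (𝓡 k) (𝓡 m) f x v) :=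
  congrArg (fun T : Tan k x →L[ℝ] A ↦ T v) (mfderiv_comp x hF hf)

theorem mvfderiv_congr {F G : M → A} {x : M} (h : F =ᶠ[𝓝 x] G) :
    mvfderiv (𝓡 k) F x = mvfderiv (𝓡 k) G x := h.mfderiv_eq

end Calculus

section Coordinates

variable {m : ℕ} {M M' : Type*} [TopologicalSpace M'] [ChartedSpace (Model m) M']
  [IsManifold (𝓡 m) ∞ M']

/-- The coordinates of a vector field along `f`, in the frame given by the chart at `f x`. -/
def coordAlong (f : M → M') (Z : Π y : M, Tan m (f y)) (x : M) (y : M) : Model m :=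
  (trivializationAt (Model m) (TangentSpace (𝓡 m) : M' → Type _) (f x) ⟨f y, Z y⟩).2

theorem coordAlong_eq_continuousLinearMapAt {f : M → M'} {x y : M} (Z : Π y : M, Tan m (f y))
    (hy : f y ∈ (trivializationAt (Model m) (TangentSpace (𝓡 m) : M' → Type _) (f x)).baseSet) :
    coordAlong f Z x y = (trivializationAt (Model m) (TangentSpace (𝓡 m) : M' → Type _)
      (f x)).continuousLinearMapAt ℝ (f y) (Z y) := by
  rw [Trivialization.continuousLinearMapAt_apply, Trivialization.linearMapAt_apply, if_pos hy]
  rfl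

theorem symmL_coordAlong {f : M → M'} {x y : M} (Z : Π y : M, Tan m (f y))
    (hy : f y ∈ (trivializationAt (Model m) (TangentSpace (𝓡 m) : M' → Type _) (f x)).baseSet) :
    (trivializationAt (Model m) (TangentSpace (𝓡 m) : M' → Type _) (f x)).symmL ℝ (f y)
      (coordAlong f Z x y) = Z y := by
  rw [coordAlong_eq_continuousLinearMapAt Z hy]
  exact Trivialization.symmL_continuousLinearMapAt _ hy _

end Coordinates

section Along

variable {k m : ℕ} {M M' : Type*} [TopologicalSpace M] [ChartedSpace (Model k) M]
  [TopologicalSpace M'] [ChartedSpace (Model m) M'] [IsManifold (𝓡 m) ∞ M']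

/-- `Z` is a vector field along `f` which is differentiable at `x`. -/
def MDifferentiableAlongAt (k : ℕ) {M M' : Type*} [TopologicalSpace M] [ChartedSpace (Model k) M]
    [TopologicalSpace M'] [ChartedSpace (Model m) M'] [IsManifold (𝓡 m) ∞ M'] (f : M → M')
    (Z : Π y : M, Tan m (f y)) (x : M) : Prop :=
  MDifferentiableAt (𝓡 k) ((𝓡 m).prod 𝓘(ℝ, Model m))
    (fun y ↦ (TotalSpace.mk' (Model m) (f y) (Z y) : TangentBundle (𝓡 m) M')) x

theorem MDifferentiableAlongAt.base {f : M → M'} {Z : Π y : M, Tan m (f y)} {x : M}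
    (h : MDifferentiableAlongAt k f Z x) : MDifferentiableAt (𝓡 k) (𝓡 m) f x :=
  ((mdifferentiableAt_totalSpace _ _).1 h).1

theorem MDifferentiableAlongAt.coord {f : M → M'} {Z : Π y : M, Tan m (f y)} {x : M}
    (h : MDifferentiableAlongAt k f Z x) :
    MDifferentiableAt (𝓡 k) 𝓘(ℝ, Model m) (coordAlong f Z x) x :=
  ((mdifferentiableAt_totalSpace _ _).1 h).2

theorem covAlong_eq (cov : AffineConnection m M') (f : M → M') (Z : Π y : M, Tan m (f y)) (x : M)
    (v : Tan k x) :
    covAlong cov f Z x v =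
      (trivializationAt (Model m) (TangentSpace (𝓡 m) : M' → Type _) (f x)).symmL ℝ (f x)
        (mvfderiv (𝓡 k) (coordAlong f Z x) x v) +
      cov (FiberBundle.extend (Model m) (Z x)) (f x) (mfderiv (𝓡 k) (𝓡 m) f x v) := by
  rw [Trivialization.symmL_apply _ (FiberBundle.mem_baseSet_trivializationAt' (f x))]
  rfl

theorem eventually_mem_baseSet_self (p : M') : ∀ᶠ q in 𝓝 p,
    q ∈ (trivializationAt (Model m) (TangentSpace (𝓡 m) : M' → Type _) p).baseSet :=
  (trivializationAt (Model m) (TangentSpace (𝓡 m) : M' → Type _) p).open_baseSet.mem_nhds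
    (FiberBundle.mem_baseSet_trivializationAt' p)

theorem eventually_mem_baseSet {f : M → M'} {x : M} (hf : ContinuousAt f x) :
    ∀ᶠ y in 𝓝 x, f y ∈
      (trivializationAt (Model m) (TangentSpace (𝓡 m) : M' → Type _) (f x)).baseSet :=
  hf.eventually (eventually_mem_baseSet_self (f x))

theorem extend_eq_symmL {p q : M'} (u : Tan m p)
    (hq : q ∈ (trivializationAt (Model m) (TangentSpace (𝓡 m) : M' → Type _) p).baseSet) :
    FiberBundle.extend (Model m) u q =
      (trivializationAt (Model m) (TangentSpace (𝓡 m) : M' → Type _) p).symmL ℝ q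
        ((trivializationAt (Model m) (TangentSpace (𝓡 m) : M' → Type _) p).continuousLinearMapAt ℝ
          p u) := by
  rw [Trivialization.continuousLinearMapAt_apply, Trivialization.linearMapAt_apply,
    if_pos (FiberBundle.mem_baseSet_trivializationAt' p), Trivialization.symmL_apply _ hq]
  rfl

theorem cov_extend_add (cov : AffineConnection m M') (p : M') (u v w : Tan m p) :
    cov (FiberBundle.extend (Model m) (u + v)) p w =
      cov (FiberBundle.extend (Model m) u) p w + cov (FiberBundle.extend (Model m) v) p w := by
  have hu := FiberBundle.mdifferentiableAt_extend (𝓡 m) (Model m) u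
  have hv := FiberBundle.mdifferentiableAt_extend (𝓡 m) (Model m) v
  rw [cov.isCovariantDerivativeOnUniv.congr_of_eventuallyEq
    (FiberBundle.mdifferentiableAt_extend (𝓡 m) (Model m) (u + v))
    (mdifferentiableAt_add_section hu hv) Filter.univ_mem ?_,
    cov.isCovariantDerivativeOnUniv.add hu hv]
  · rfl
  · filter_upwards [eventually_mem_baseSet_self (m := m) p] with q hq
    rw [Pi.add_apply]
    simp only [extend_eq_symmL _ hq, map_add]

theorem cov_extend_smul (cov : AffineConnection m M') (p : M') (c : ℝ) (u w : Tan m p) :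
    cov (FiberBundle.extend (Model m) (c • u)) p w =
      c • cov (FiberBundle.extend (Model m) u) p w := by
  have hu := FiberBundle.mdifferentiableAt_extend (𝓡 m) (Model m) u
  rw [cov.isCovariantDerivativeOnUniv.congr_of_eventuallyEq
    (FiberBundle.mdifferentiableAt_extend (𝓡 m) (Model m) (c • u))
    (mdifferentiableAt_const.smul_section hu) Filter.univ_mem (σ' := (fun _ ↦ c) • _) ?_]
  · exact congrArg (fun A ↦ A w) (cov.isCovariantDerivativeOnUniv.smul_const c hu)
  · filter_upwards [eventually_mem_baseSet_self (m := m) p] with q hq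
    rw [Pi.smul_apply']
    simp only [extend_eq_symmL _ hq, map_smul]

theorem covAlong_add_field (cov : AffineConnection m M') {f : M → M'} {Z W : Π y : M, Tan m (f y)}
    {x : M} (hZ : MDifferentiableAlongAt k f Z x) (hW : MDifferentiableAlongAt k f W x)
    (v : Tan k x) :
    covAlong cov f (fun y ↦ Z y + W y) x v = covAlong cov f Z x v + covAlong cov f W x v := by
  have h : coordAlong f (fun y ↦ Z y + W y) x =ᶠ[𝓝 x] coordAlong f Z x + coordAlong f W x := by
    filter_upwards [eventually_mem_baseSet (m := m) hZ.base.continuousAt] with y hy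
    rw [Pi.add_apply]
    simp only [coordAlong_eq_continuousLinearMapAt _ hy, map_add]
  have h' : mvfderiv (𝓡 k) (coordAlong f (fun y ↦ Z y + W y) x) x v =
      mvfderiv (𝓡 k) (coordAlong f Z x) x v + mvfderiv (𝓡 k) (coordAlong f W x) x v := by
    rw [show mvfderiv (𝓡 k) (coordAlong f (fun y ↦ Z y + W y) x) x =
      mvfderiv (𝓡 k) (coordAlong f Z x + coordAlong f W x) x from h.mfderiv_eq,
      mvfderiv_add hZ.coord hW.coord]
    rfl
  rw [covAlong_eq, covAlong_eq, covAlong_eq, h', cov_extend_add, map_add]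
  abel

theorem covAlong_smul_field (cov : AffineConnection m M') {f : M → M'} {Z : Π y : M, Tan m (f y)}
    {x : M} {φ : M → ℝ} (hφ : MDifferentiableAt (𝓡 k) 𝓘(ℝ, ℝ) φ x)
    (hZ : MDifferentiableAlongAt k f Z x) (v : Tan k x) :
    covAlong cov f (fun y ↦ φ y • Z y) x v =
      mvfderiv (𝓡 k) φ x v • Z x + φ x • covAlong cov f Z x v := by
  have h : coordAlong f (fun y ↦ φ y • Z y) x =ᶠ[𝓝 x] φ • coordAlong f Z x := by
    filter_upwards [eventually_mem_baseSet (m := m) hZ.base.continuousAt] with y hy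
    rw [Pi.smul_apply']
    simp only [coordAlong_eq_continuousLinearMapAt _ hy, map_smul]
  have h' : mvfderiv (𝓡 k) (coordAlong f (fun y ↦ φ y • Z y) x) x v =
      φ x • mvfderiv (𝓡 k) (coordAlong f Z x) x v + mvfderiv (𝓡 k) φ x v • coordAlong f Z x x := by
    rw [show mvfderiv (𝓡 k) (coordAlong f (fun y ↦ φ y • Z y) x) x =
      mvfderiv (𝓡 k) (φ • coordAlong f Z x) x from h.mfderiv_eq,
      mvfderiv_smul hφ hZ.coord]
    rfl
  rw [covAlong_eq, covAlong_eq, h', cov_extend_smul, map_add, map_smul, map_smul,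
    symmL_coordAlong _ (FiberBundle.mem_baseSet_trivializationAt' (f x)), smul_add]
  abel

theorem covAlong_add (cov : AffineConnection m M') (f : M → M') (Z : Π y : M, Tan m (f y)) (x : M)
    (v w : Tan k x) : covAlong cov f Z x (v + w) = covAlong cov f Z x v + covAlong cov f Z x w := by
  simp only [covAlong_eq, map_add]
  abel

/-- The metric in the coordinates given by the chart at `p`. -/
def coordMetric (g : LorentzMetric m M') (p q : M') : Model m →L[ℝ] Model m →L[ℝ] ℝ :=
  ContinuousLinearMap.inCoordinates (Model m) (TangentSpace (𝓡 m) : M' → Type _)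
    (Model m →L[ℝ] ℝ) (fun p : M' ↦ Tan m p →L[ℝ] ℝ) p q p q (g.form q)

theorem mdifferentiableAt_coordMetric (g : LorentzMetric m M') (p : M') :
    MDifferentiableAt (𝓡 m) 𝓘(ℝ, Model m →L[ℝ] Model m →L[ℝ] ℝ) (coordMetric g p) p :=
  ((mdifferentiableAt_hom_bundle _).1 ((g.smooth p).mdifferentiableAt (by simp))).2

theorem coordMetric_apply (g : LorentzMetric m M') {p q : M'}
    (hq : q ∈ (trivializationAt (Model m) (TangentSpace (𝓡 m) : M' → Type _) p).baseSet)
    (a b : Model m) :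
    coordMetric g p q a b = g.form q
      ((trivializationAt (Model m) (TangentSpace (𝓡 m) : M' → Type _) p).symmL ℝ q a)
      ((trivializationAt (Model m) (TangentSpace (𝓡 m) : M' → Type _) p).symmL ℝ q b) := by
  rw [coordMetric, inCoordinates_apply_eq₂ hq hq (by simp)]
  rw [Trivialization.symmL_apply _ hq, Trivialization.symmL_apply _ hq]
  simp

/-- The connection along `f` induced by a Levi-Civita connection is metric. -/
theorem IsLeviCivita.mvfderiv_form_along {g : LorentzMetric m M'} {cov : AffineConnection m M'}
    (hcov : IsLeviCivita g cov) {f : M → M'} {Z W : Π y : M, Tan m (f y)} {x : M}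
    (hZ : MDifferentiableAlongAt k f Z x) (hW : MDifferentiableAlongAt k f W x) (v : Tan k x) :
    mvfderiv (𝓡 k) (fun y ↦ g.form (f y) (Z y) (W y)) x v =
      g.form (f x) (covAlong cov f Z x v) (W x) + g.form (f x) (Z x) (covAlong cov f W x v) := by
  set p := f x with hp
  have hpb := FiberBundle.mem_baseSet_trivializationAt' (F := Model m)
    (E := (TangentSpace (𝓡 m) : M' → Type _)) p
  have hG := mdifferentiableAt_coordMetric g p
  -- the derivative of the metric in coordinates is given by the connection on the chart frame
  have h1 (u : Tan m p) : mvfderiv (𝓡 m) (coordMetric g p) p u (coordAlong f Z x x)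
      (coordAlong f W x x) = g.form p (cov (FiberBundle.extend (Model m) (Z x)) p u) (W x) +
        g.form p (Z x) (cov (FiberBundle.extend (Model m) (W x)) p u) := by
    have h := hcov.metric p u _ _ (FiberBundle.mdifferentiableAt_extend (𝓡 m) (Model m) (Z x))
      (FiberBundle.mdifferentiableAt_extend (𝓡 m) (Model m) (W x))
    rw [FiberBundle.extend_apply_self, FiberBundle.extend_apply_self] at h
    rw [← h]
    have he : (fun q ↦ g.form q (FiberBundle.extend (Model m) (Z x) q)
        (FiberBundle.extend (Model m) (W x) q)) =ᶠ[𝓝 p]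
        fun q ↦ coordMetric g p q (coordAlong f Z x x) (coordAlong f W x x) := by
      filter_upwards [eventually_mem_baseSet_self (m := m) p] with q hq
      rw [coordMetric_apply g hq, extend_eq_symmL _ hq, extend_eq_symmL _ hq,
        coordAlong_eq_continuousLinearMapAt _ hpb, coordAlong_eq_continuousLinearMapAt _ hpb]
    rw [mvfderiv_congr he, mvfderiv_clm_apply₂ hG mdifferentiableAt_const mdifferentiableAt_const]
    simp only [mvfderiv_const, zero_apply, map_zero, add_zero]
  have he : (fun y ↦ g.form (f y) (Z y) (W y)) =ᶠ[𝓝 x]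
      fun y ↦ coordMetric g p (f y) (coordAlong f Z x y) (coordAlong f W x y) := by
    filter_upwards [eventually_mem_baseSet (m := m) hZ.base.continuousAt] with y hy
    rw [coordMetric_apply g hy, symmL_coordAlong _ hy, symmL_coordAlong _ hy]
  rw [mvfderiv_congr he, mvfderiv_clm_apply₂ (G := fun y ↦ coordMetric g p (f y))
      (hG.comp x hZ.base) hZ.coord hW.coord,
    mvfderiv_comp_mfderiv hG hZ.base, h1, coordMetric_apply g hpb, coordMetric_apply g hpb,
    symmL_coordAlong _ hpb, symmL_coordAlong _ hpb, covAlong_eq, covAlong_eq, map_add, map_add,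
    add_apply]
  abel

end Along

/-! ### Torsion-free connections along a map -/

section Torsion

variable {k m : ℕ} {M M' : Type*} [TopologicalSpace M] [ChartedSpace (Model k) M]
  [TopologicalSpace M'] [ChartedSpace (Model m) M'] [IsManifold (𝓡 m) ∞ M']

theorem mem_chart_source_of_mem_baseSet {p q : M'}
    (hq : q ∈ (trivializationAt (Model m) (TangentSpace (𝓡 m) : M' → Type _) p).baseSet) :
    q ∈ (chartAt (Model m) p).source := by
  simpa using hq

theorem continuousLinearMapAt_eq_mvfderiv {p q : M'}
    (hq : q ∈ (trivializationAt (Model m) (TangentSpace (𝓡 m) : M' → Type _) p).baseSet)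
    (u : Tan m q) :
    (trivializationAt (Model m) (TangentSpace (𝓡 m) : M' → Type _) p).continuousLinearMapAt ℝ q u =
      mvfderiv (𝓡 m) (extChartAt (𝓡 m) p) q u := by
  rw [TangentBundle.continuousLinearMapAt_trivializationAt (mem_chart_source_of_mem_baseSet hq)]
  rfl

/-- The extensions of tangent vectors by constant coefficients in a chart commute. -/
theorem mlieBracket_extend (p : M') (u v : Tan m p) :
    VectorField.mlieBracket (𝓡 m) (FiberBundle.extend (Model m) u : Π q : M', Tan m q)
      (FiberBundle.extend (Model m) v) p = 0 := by
  have hc (w : Tan m p) : (fun q ↦ mvfderiv (𝓡 m) (extChartAt (𝓡 m) p) q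
      (FiberBundle.extend (Model m) w q)) =ᶠ[𝓝 p] fun _ ↦
        (trivializationAt (Model m) (TangentSpace (𝓡 m) : M' → Type _) p).continuousLinearMapAt ℝ
          p w := by
    filter_upwards [eventually_mem_baseSet_self (m := m) p] with q hq
    rw [extend_eq_symmL _ hq, ← continuousLinearMapAt_eq_mvfderiv hq,
      Trivialization.continuousLinearMapAt_symmL _ hq]
  have h := mvfderiv_mlieBracket (x := p) (F := extChartAt (𝓡 m) p) contMDiffAt_extChartAt
    (FiberBundle.mdifferentiableAt_extend (𝓡 m) (Model m) u)
    (FiberBundle.mdifferentiableAt_extend (𝓡 m) (Model m) v)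
  rw [mvfderiv_congr (hc v), mvfderiv_congr (hc u), mvfderiv_const, mvfderiv_const] at h
  have hpb := FiberBundle.mem_baseSet_trivializationAt' (F := Model m)
    (E := (TangentSpace (𝓡 m) : M' → Type _)) p
  rw [← continuousLinearMapAt_eq_mvfderiv hpb] at h
  rw [← Trivialization.symmL_continuousLinearMapAt (R := ℝ) _ hpb
    (VectorField.mlieBracket (𝓡 m) _ _ p), h]
  simp

theorem coordAlong_mfderiv_eventuallyEq {f : M → M'} {x : M} (hf : ContMDiff (𝓡 k) (𝓡 m) ∞ f)
    (Y : Π y : M, Tan k y) :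
    coordAlong f (fun y ↦ mfderiv (𝓡 k) (𝓡 m) f y (Y y)) x =ᶠ[𝓝 x]
      fun y ↦ mvfderiv (𝓡 k) (fun z ↦ extChartAt (𝓡 m) (f x) (f z)) y (Y y) := by
  filter_upwards [eventually_mem_baseSet (m := m) (hf x).continuousAt] with y hy
  rw [coordAlong_eq_continuousLinearMapAt _ hy, continuousLinearMapAt_eq_mvfderiv hy,
    mvfderiv_comp_mfderiv (mdifferentiableAt_extChartAt (mem_chart_source_of_mem_baseSet hy))
      ((hf y).mdifferentiableAt (by simp))]

/-- The connection along `f` induced by a torsion-free connection is torsion-free. -/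
theorem IsLeviCivita.covAlong_sub_covAlong [IsManifold (𝓡 k) ∞ M] {g : LorentzMetric m M'}
    {cov : AffineConnection m M'} (hcov : IsLeviCivita g cov) {f : M → M'} {x : M}
    (hf : ContMDiff (𝓡 k) (𝓡 m) ∞ f) {X Y : Π y : M, Tan k y}
    (hX : MDifferentiableAt (𝓡 k) ((𝓡 k).prod 𝓘(ℝ, Model k))
      (fun y ↦ TotalSpace.mk' (Model k) y (X y)) x)
    (hY : MDifferentiableAt (𝓡 k) ((𝓡 k).prod 𝓘(ℝ, Model k))
      (fun y ↦ TotalSpace.mk' (Model k) y (Y y)) x) :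
    covAlong cov f (fun y ↦ mfderiv (𝓡 k) (𝓡 m) f y (Y y)) x (X x) -
        covAlong cov f (fun y ↦ mfderiv (𝓡 k) (𝓡 m) f y (X y)) x (Y x) =
      mfderiv (𝓡 k) (𝓡 m) f x (VectorField.mlieBracket (𝓡 k) X Y x) := by
  have hb := FiberBundle.mem_baseSet_trivializationAt' (F := Model m)
    (E := (TangentSpace (𝓡 m) : M' → Type _)) (f x)
  have hφ : ContMDiffAt (𝓡 m) 𝓘(ℝ, Model m) ∞ (extChartAt (𝓡 m) (f x)) (f x) :=
    contMDiffAt_extChartAt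
  have h1 := mvfderiv_mlieBracket (F := fun z ↦ extChartAt (𝓡 m) (f x) (f z))
    (hφ.comp x (hf x)) hX hY
  rw [← mvfderiv_congr (coordAlong_mfderiv_eventuallyEq hf Y),
    ← mvfderiv_congr (coordAlong_mfderiv_eventuallyEq hf X),
    mvfderiv_comp_mfderiv (hφ.mdifferentiableAt (by simp)) ((hf x).mdifferentiableAt (by simp)),
    ← continuousLinearMapAt_eq_mvfderiv hb] at h1
  have h2 := cov.torsion_eq_zero_iff.1 hcov.torsion
    (FiberBundle.mdifferentiableAt_extend (𝓡 m) (Model m) (mfderiv (𝓡 k) (𝓡 m) f x (X x)))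
    (FiberBundle.mdifferentiableAt_extend (𝓡 m) (Model m) (mfderiv (𝓡 k) (𝓡 m) f x (Y x)))
  rw [mlieBracket_extend, FiberBundle.extend_apply_self, FiberBundle.extend_apply_self] at h2
  rw [covAlong_eq, covAlong_eq, add_sub_add_comm, h2, add_zero, ← map_sub, ← h1,
    Trivialization.symmL_continuousLinearMapAt _ hb]

end Torsion

/-! ### Vector fields and the induced connection -/

section SmoothFields

variable {m : ℕ} {M : Type*} [TopologicalSpace M] [ChartedSpace (Model m) M]
  [IsManifold (𝓡 m) ∞ M]

theorem IsSmoothField.mdifferentiableAt {X : Π x : M, Tan m x} (hX : IsSmoothField X) (x : M) :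
    MDifferentiableAt (𝓡 m) ((𝓡 m).prod 𝓘(ℝ, Model m))
      (fun y ↦ TotalSpace.mk' (Model m) y (X y)) x :=
  (hX x).mdifferentiableAt (by simp)

theorem IsSmoothField.add {X Y : Π x : M, Tan m x} (hX : IsSmoothField X) (hY : IsSmoothField Y) :
    IsSmoothField (fun x ↦ X x + Y x) := ContMDiff.add_section hX hY

theorem IsSmoothField.sub {X Y : Π x : M, Tan m x} (hX : IsSmoothField X) (hY : IsSmoothField Y) :
    IsSmoothField (fun x ↦ X x - Y x) := ContMDiff.sub_section hX hY

theorem IsSmoothField.smul {X : Π x : M, Tan m x} {f : M → ℝ} (hX : IsSmoothField X)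
    (hf : ContMDiff (𝓡 m) 𝓘(ℝ, ℝ) ∞ f) : IsSmoothField (fun x ↦ f x • X x) :=
  ContMDiff.smul_section hf hX

theorem IsSmoothEndomorphism.apply {S : Π x : M, Tan m x →L[ℝ] Tan m x}
    (hS : IsSmoothEndomorphism S) {X : Π x : M, Tan m x} (hX : IsSmoothField X) :
    IsSmoothField (fun x ↦ S x (X x)) := ContMDiff.clm_bundle_apply hS hX

/-- Every tangent vector is the value of a globally defined smooth vector field. -/
theorem exists_isSmoothField [T2Space M] (x : M) (v : Tan m x) :
    ∃ X : Π y : M, Tan m y, IsSmoothField X ∧ X x = v := by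
  obtain ⟨s, hs, hsv⟩ := FiberBundle.exists_contMDiffOn_extend (k := ∞) (𝓡 m) (Model m) v
  obtain ⟨t, hts, ht, hxt⟩ := mem_nhds_iff.1 hs
  obtain ⟨ψ, -, hψ⟩ := (SmoothBumpFunction.nhds_basis_tsupport (I := 𝓡 m) x).mem_iff.1
    (ht.mem_nhds hxt)
  refine ⟨fun y ↦ ψ y • FiberBundle.extend (Model m) v y,
    ContMDiffOn.smul_section_of_tsupport ψ.contMDiff.contMDiffOn ht hψ (hsv.mono hts), ?_⟩
  simp

end SmoothFields

namespace Hypersurface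

section Connection

variable {n : ℕ} {M' : Type*} [TopologicalSpace M'] [ChartedSpace (Model (n + 2)) M']
  [IsManifold (𝓡 (n + 2)) ∞ M'] {g : LorentzMetric (n + 2) M'}
  {M : Type*} [TopologicalSpace M] [ChartedSpace (Model (n + 1)) M]
  [IsManifold (𝓡 (n + 1)) ∞ M] (L : Hypersurface n g M) (cov : AffineConnection (n + 2) M')

theorem mdifferentiableAlongAt_d {Y : Π x : M, Tan (n + 1) x} (hY : IsSmoothField Y) (x : M) :
    MDifferentiableAlongAt (n + 1) L.imm (fun y ↦ L.d y (Y y)) x := by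
  have h := (L.smooth_imm.contMDiff_tangentMap (m := ∞) (by simp)).comp hY
  exact (h x).mdifferentiableAt (by simp)

theorem inducedDeriv_add_field {Y Z : Π x : M, Tan (n + 1) x} (hY : IsSmoothField Y)
    (hZ : IsSmoothField Z) (x : M) (v : Tan (n + 1) x) :
    L.inducedDeriv cov (fun y ↦ Y y + Z y) x v =
      L.inducedDeriv cov Y x v + L.inducedDeriv cov Z x v := by
  have h := covAlong_add_field cov (L.mdifferentiableAlongAt_d hY x)
    (L.mdifferentiableAlongAt_d hZ x) v
  simp only [← map_add] at h
  simp only [inducedDeriv, ambientDeriv, ← map_add, h]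

theorem Q_d (x : M) (v : Tan (n + 1) x) : L.Q x (L.d x v) = v := by
  have h : Submodule.projectionOnto (L.tangent x) (L.tr x) (L.isCompl_tangent_tr x) (L.d x v) =
      ⟨L.d x v, v, rfl⟩ :=
    Submodule.projectionOnto_apply_left (L.isCompl_tangent_tr x) ⟨L.d x v, v, rfl⟩
  refine (congrArg (LinearEquiv.ofInjective (L.d x : Tan (n + 1) x →ₗ[ℝ] Tan (n + 2) (L.imm x))
    (L.d_injective x)).symm h).trans ?_
  exact (LinearEquiv.symm_apply_eq _).2 rfl

theorem inducedDeriv_smul_field {f : M → ℝ} (hf : ContMDiff (𝓡 (n + 1)) 𝓘(ℝ, ℝ) ∞ f)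
    {Y : Π x : M, Tan (n + 1) x} (hY : IsSmoothField Y) (x : M) (v : Tan (n + 1) x) :
    L.inducedDeriv cov (fun y ↦ f y • Y y) x v =
      mvfderiv (𝓡 (n + 1)) f x v • Y x + f x • L.inducedDeriv cov Y x v := by
  have h := covAlong_smul_field cov ((hf x).mdifferentiableAt (by simp))
    (L.mdifferentiableAlongAt_d hY x) v
  have h' : L.ambientDeriv cov (fun y ↦ f y • Y y) x v =
      mvfderiv (𝓡 (n + 1)) f x v • L.d x (Y x) + f x • L.ambientDeriv cov Y x v := by
    refine Eq.trans ?_ h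
    simp only [ambientDeriv, map_smul]
  rw [inducedDeriv, h', map_add, map_smul, map_smul, Q_d]
  rfl

theorem inducedDeriv_add (Y : Π x : M, Tan (n + 1) x) (x : M) (v w : Tan (n + 1) x) :
    L.inducedDeriv cov Y x (v + w) = L.inducedDeriv cov Y x v + L.inducedDeriv cov Y x w := by
  simp only [inducedDeriv, ambientDeriv, covAlong_add, map_add]

variable {cov}

theorem inducedDeriv_sub_inducedDeriv (hcov : IsLeviCivita g cov) {X Y : Π x : M, Tan (n + 1) x}
    (hX : IsSmoothField X) (hY : IsSmoothField Y) (x : M) :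
    L.inducedDeriv cov Y x (X x) - L.inducedDeriv cov X x (Y x) =
      VectorField.mlieBracket (𝓡 (n + 1)) X Y x := by
  have h := hcov.covAlong_sub_covAlong L.smooth_imm (hX.mdifferentiableAt x)
    (hY.mdifferentiableAt x)
  rw [inducedDeriv, inducedDeriv, ← map_sub]
  exact (congrArg (L.Q x) h).trans (L.Q_d x _)

theorem d_inducedDeriv [T2Space M] (hL : L.IsTotallyGeodesic cov) {Y : Π x : M, Tan (n + 1) x}
    (hY : IsSmoothField Y) (x : M) (v : Tan (n + 1) x) :
    L.d x (L.inducedDeriv cov Y x v) = L.ambientDeriv cov Y x v := by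
  obtain ⟨X, hX, rfl⟩ := exists_isSmoothField x v
  exact (sub_eq_zero.1 (hL X Y hX hY x)).symm

/-- On a totally geodesic lightlike hypersurface the induced connection is metric. -/
theorem mvfderiv_metric [T2Space M] (hcov : IsLeviCivita g cov) (hL : L.IsTotallyGeodesic cov)
    {Y Z : Π x : M, Tan (n + 1) x} (hY : IsSmoothField Y) (hZ : IsSmoothField Z) (x : M)
    (v : Tan (n + 1) x) :
    mvfderiv (𝓡 (n + 1)) (fun y ↦ L.metric y (Y y) (Z y)) x v =
      L.metric x (L.inducedDeriv cov Y x v) (Z x) +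
        L.metric x (Y x) (L.inducedDeriv cov Z x v) := by
  rw [metric_apply, metric_apply, L.d_inducedDeriv hL hY, L.d_inducedDeriv hL hZ]
  exact hcov.mvfderiv_form_along (L.mdifferentiableAlongAt_d hY x)
    (L.mdifferentiableAlongAt_d hZ x) v

end Connection

end Hypersurface

/-! ### Diagonalizable endomorphisms with three eigenvalues -/

section LinearAlgebra

variable {V : Type*} [AddCommGroup V] [Module ℝ V]

/-- An endomorphism which is symmetric for a positive definite symmetric bilinear form is
diagonalizable. -/
theorem iSup_eigenspace_eq_top_of_posDef [FiniteDimensional ℝ V] (B : V →ₗ[ℝ] V →ₗ[ℝ] ℝ)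
    (hB : ∀ v w, B v w = B w v) (hpos : ∀ v, v ≠ 0 → 0 < B v v) (T : V →ₗ[ℝ] V)
    (hT : ∀ v w, B (T v) w = B v (T w)) : ⨆ c : ℝ, Module.End.eigenspace T c = ⊤ := by
  let core : InnerProductSpace.Core ℝ V :=
    { inner := fun v w ↦ B v w
      conj_inner_symm := fun v w ↦ hB w v
      re_inner_nonneg := fun v ↦ by
        by_cases hv : v = 0
        · simp [hv]
        · exact (hpos v hv).le
      add_left := fun u v w ↦ by simp
      smul_left := fun u v c ↦ by simp
      definite := fun v hv ↦ by
        by_contra h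
        exact (hpos v h).ne' hv }
  let : NormedAddCommGroup V := core.toNormedAddCommGroup
  let : InnerProductSpace ℝ V := InnerProductSpace.ofCore core.toCore
  have hsymm : T.IsSymmetric := fun v w ↦ hT v w
  have h := hsymm.orthogonalComplement_iSup_eigenspaces_eq_bot
  exact (Submodule.orthogonal_eq_bot_iff).1 h

variable (T : V →ₗ[ℝ] V)

/-- The Lagrange interpolation polynomial in `T` which projects onto the eigenspace of `a` when
`T` is diagonalizable with eigenvalues `a`, `b`, `c`. -/
def eigenProj (a b c : ℝ) : V →ₗ[ℝ] V :=
  ((a - b) * (a - c))⁻¹ • (T ∘ₗ T - (b + c) • T + (b * c) • LinearMap.id)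

theorem eigenProj_apply (a b c : ℝ) (v : V) : eigenProj T a b c v =
    ((a - b) * (a - c))⁻¹ • (T (T v) - (b + c) • T v + (b * c) • v) := rfl

theorem eigenProj_comm (a b c : ℝ) : eigenProj T a b c = eigenProj T a c b := by
  simp only [eigenProj, mul_comm, add_comm]

variable {T} {a b c : ℝ}

theorem eigenProj_of_mem (hab : a ≠ b) (hac : a ≠ c) {v : V} (hv : v ∈ Module.End.eigenspace T a) :
    eigenProj T a b c v = v := by
  rw [Module.End.mem_eigenspace_iff] at hv
  have h1 := sub_ne_zero.2 hab
  have h2 := sub_ne_zero.2 hac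
  rw [eigenProj_apply, hv, map_smul, hv]
  match_scalars
  field_simp
  ring

theorem eigenProj_of_mem_left {v : V} (hv : v ∈ Module.End.eigenspace T b) :
    eigenProj T a b c v = 0 := by
  rw [Module.End.mem_eigenspace_iff] at hv
  rw [eigenProj_apply, hv, map_smul, hv]
  match_scalars
  ring

theorem eigenProj_of_mem_right {v : V} (hv : v ∈ Module.End.eigenspace T c) :
    eigenProj T a b c v = 0 := by
  rw [eigenProj_comm, eigenProj_of_mem_left hv]

theorem exists_eigen_decomposition (h : Module.End.eigenspace T a ⊔ Module.End.eigenspace T b ⊔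
    Module.End.eigenspace T c = ⊤) (v : V) : ∃ x ∈ Module.End.eigenspace T a,
      ∃ y ∈ Module.End.eigenspace T b, ∃ z ∈ Module.End.eigenspace T c, v = x + y + z := by
  obtain ⟨u, hu, z, hz, rfl⟩ := Submodule.mem_sup.1 (h ▸ Submodule.mem_top : v ∈ _ ⊔ _)
  obtain ⟨x, hx, y, hy, rfl⟩ := Submodule.mem_sup.1 hu
  exact ⟨x, hx, y, hy, z, hz, rfl⟩

theorem eigenProj_mem (h : Module.End.eigenspace T a ⊔ Module.End.eigenspace T b ⊔
    Module.End.eigenspace T c = ⊤) (hab : a ≠ b) (hac : a ≠ c) (v : V) :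
    eigenProj T a b c v ∈ Module.End.eigenspace T a := by
  obtain ⟨x, hx, y, hy, z, hz, rfl⟩ := exists_eigen_decomposition h v
  rw [map_add, map_add, eigenProj_of_mem hab hac hx, eigenProj_of_mem_left hy,
    eigenProj_of_mem_right hz, add_zero, add_zero]
  exact hx

theorem trace_eigenProj [FiniteDimensional ℝ V] (h : Module.End.eigenspace T a ⊔
    Module.End.eigenspace T b ⊔ Module.End.eigenspace T c = ⊤) (hab : a ≠ b) (hac : a ≠ c) :
    LinearMap.trace ℝ V (eigenProj T a b c) = Module.finrank ℝ (Module.End.eigenspace T a) :=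
  LinearMap.IsProj.trace ⟨eigenProj_mem h hab hac, fun _ hv ↦ eigenProj_of_mem hab hac hv⟩

theorem eigenProj_add_add (hab : a ≠ b) (hac : a ≠ c) (hbc : b ≠ c) (v : V) :
    eigenProj T a b c v + eigenProj T b a c v + eigenProj T c a b v = v := by
  have h1 := sub_ne_zero.2 hab
  have h2 := sub_ne_zero.2 hac
  have h3 := sub_ne_zero.2 hbc
  have h1' := sub_ne_zero.2 hab.symm
  have h2' := sub_ne_zero.2 hac.symm
  have h3' := sub_ne_zero.2 hbc.symm
  simp only [eigenProj_apply]
  match_scalars <;> field_simp <;> ring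

/-- The dimension and the trace in terms of the multiplicities of the eigenvalues. -/
theorem finrank_and_trace_of_eigen_decomposition [FiniteDimensional ℝ V]
    (h : Module.End.eigenspace T a ⊔ Module.End.eigenspace T b ⊔ Module.End.eigenspace T c = ⊤)
    (hab : a ≠ b) (hac : a ≠ c) (hbc : b ≠ c) :
    (Module.finrank ℝ V : ℝ) = Module.finrank ℝ (Module.End.eigenspace T a) +
        Module.finrank ℝ (Module.End.eigenspace T b) +
        Module.finrank ℝ (Module.End.eigenspace T c) ∧
      LinearMap.trace ℝ V T = a * Module.finrank ℝ (Module.End.eigenspace T a) +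
        b * Module.finrank ℝ (Module.End.eigenspace T b) +
        c * Module.finrank ℝ (Module.End.eigenspace T c) := by
  have hb : Module.End.eigenspace T b ⊔ Module.End.eigenspace T a ⊔
      Module.End.eigenspace T c = ⊤ := by
    rw [← h, sup_comm (Module.End.eigenspace T a)]
  have hc : Module.End.eigenspace T c ⊔ Module.End.eigenspace T a ⊔
      Module.End.eigenspace T b = ⊤ := by
    rw [← h, sup_assoc, sup_comm]
  rw [← trace_eigenProj h hab hac, ← trace_eigenProj hb hab.symm hbc,
    ← trace_eigenProj hc hac.symm hbc.symm]
  constructor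
  · rw [← map_add, ← map_add, ← LinearMap.trace_id]
    congr 1
    ext v
    exact (eigenProj_add_add hab hac hbc v).symm
  · rw [← smul_eq_mul, ← smul_eq_mul, ← smul_eq_mul, ← map_smul, ← map_smul, ← map_smul,
      ← map_add, ← map_add]
    congr 1
    ext v
    obtain ⟨x, hx, y, hy, z, hz, rfl⟩ := exists_eigen_decomposition h v
    simp only [map_add, LinearMap.add_apply, LinearMap.smul_apply, eigenProj_of_mem hab hac hx,
      eigenProj_of_mem_left hy, eigenProj_of_mem_right hz, eigenProj_of_mem_left hx,
      eigenProj_of_mem hab.symm hbc hy, eigenProj_of_mem_right hy, eigenProj_of_mem hac.symm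
      hbc.symm hz, Module.End.mem_eigenspace_iff.1 hx, Module.End.mem_eigenspace_iff.1 hy,
      Module.End.mem_eigenspace_iff.1 hz]
    simp

end LinearAlgebra

/-! ### Linear algebra of a lightlike hypersurface -/

theorem mem_eigenDistribution {m : ℕ} {M : Type*} [TopologicalSpace M] [ChartedSpace (Model m) M]
    {S : Π x : M, Tan m x →L[ℝ] Tan m x} {f : M → ℝ} {x : M} {v : Tan m x} :
    v ∈ eigenDistribution S f x ↔ S x v = f x • v := Module.End.mem_eigenspace_iff

namespace Hypersurface

section Pointwise

variable {n : ℕ} {M' : Type*} [TopologicalSpace M'] [ChartedSpace (Model (n + 2)) M']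
  [IsManifold (𝓡 (n + 2)) ∞ M'] {g : LorentzMetric (n + 2) M'}
  {M : Type*} [TopologicalSpace M] [ChartedSpace (Model (n + 1)) M]
  [IsManifold (𝓡 (n + 1)) ∞ M] (L : Hypersurface n g M)

theorem metric_comm (x : M) (v w : Tan (n + 1) x) : L.metric x v w = L.metric x w v := by
  rw [metric_apply, metric_apply, g.symm]

/-- The induced metric is positive on vectors outside the radical: subtracting a multiple of the
null vector `ξ` makes such a vector orthogonal to a timelike direction. -/
theorem metric_self_pos {x : M} {v : Tan (n + 1) x} (hv : v ∉ L.rad x) : 0 < L.metric x v v := by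
  obtain ⟨t, -, ht⟩ := g.signature (L.imm x)
  have hξ : L.d x (L.ξ x) ≠ 0 := fun h ↦ L.ξ_ne_zero x (L.d_injective x (by rw [h, map_zero]))
  have ha : g.form (L.imm x) t (L.d x (L.ξ x)) ≠ 0 := fun h ↦
    (ht _ h hξ).ne' (L.form_ξ x (L.ξ x))
  set c := g.form (L.imm x) t (L.d x v) / g.form (L.imm x) t (L.d x (L.ξ x)) with hc
  have hvξ : g.form (L.imm x) (L.d x v) (L.d x (L.ξ x)) = 0 := by
    rw [g.symm, L.form_ξ]
  have h := ht (L.d x v - c • L.d x (L.ξ x))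
    (by rw [map_sub, map_smul, smul_eq_mul, hc, div_mul_cancel₀ _ ha, sub_self]) fun h ↦ hv (by
      rw [sub_eq_zero, ← map_smul] at h
      rw [L.d_injective x h]
      exact Submodule.smul_mem _ _ (L.ξ_mem_rad x))
  simpa [L.form_ξ, hvξ] using h

theorem mem_rad_of_metric_self {x : M} {v : Tan (n + 1) x} (hv : L.metric x v v = 0) :
    v ∈ L.rad x := by
  by_contra h
  exact (L.metric_self_pos h).ne' hv

theorem metric_of_mem_rad_left {x : M} {v : Tan (n + 1) x} (hv : v ∈ L.rad x)
    (w : Tan (n + 1) x) : L.metric x v w = 0 := hv w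

theorem eq_zero_of_mem_screen_of_mem_rad {x : M} {v : Tan (n + 1) x} (h : v ∈ L.screen x)
    (h' : v ∈ L.rad x) : v = 0 := Submodule.disjoint_def.1 (L.isCompl x).disjoint v h h'

theorem η_ξ (x : M) : L.η x (L.ξ x) = 1 := (L.N_spec x).1

theorem η_of_mem_screen {x : M} {v : Tan (n + 1) x} (hv : v ∈ L.screen x) : L.η x v = 0 :=
  (L.N_spec x).2.2 v hv

theorem flat_self_pos {x : M} {v : Tan (n + 1) x} (hv : v ≠ 0) : 0 < L.flat x v v := by
  rw [flat_apply]
  by_cases h : v ∈ L.rad x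
  · obtain ⟨c, rfl⟩ := L.exists_smul_of_mem_rad h
    have hc : c ≠ 0 := fun hc ↦ hv (by rw [hc, zero_smul])
    rw [L.metric_of_mem_rad_left h, map_smul, L.η_ξ, zero_add, smul_eq_mul, mul_one]
    exact mul_self_pos.2 hc
  · exact add_pos_of_pos_of_nonneg (L.metric_self_pos h) (mul_self_nonneg _)

theorem flat_of_mem_screen {x : M} {v : Tan (n + 1) x} (hv : v ∈ L.screen x) (w : Tan (n + 1) x) :
    L.flat x v w = L.metric x v w := by
  rw [flat_apply, L.η_of_mem_screen hv, zero_mul, add_zero]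

theorem P_mem_screen (x : M) (v : Tan (n + 1) x) : L.P x v ∈ L.screen x :=
  Submodule.projection_apply_mem (L.isCompl x) v

theorem P_of_mem_screen {x : M} {v : Tan (n + 1) x} (hv : v ∈ L.screen x) : L.P x v = v :=
  (Submodule.projection_eq_self_iff (L.isCompl x) v).2 hv

theorem P_of_mem_rad {x : M} {v : Tan (n + 1) x} (hv : v ∈ L.rad x) : L.P x v = 0 :=
  (Submodule.projection_apply_eq_zero_iff (L.isCompl x)).2 hv

theorem exists_eq_P_add_smul_ξ (x : M) (v : Tan (n + 1) x) : ∃ c : ℝ, v = L.P x v + c • L.ξ x := by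
  obtain ⟨a, ha, b, hb, rfl⟩ := Submodule.mem_sup.1
    ((L.isCompl x).sup_eq_top ▸ Submodule.mem_top : v ∈ L.screen x ⊔ L.rad x)
  obtain ⟨c, rfl⟩ := L.exists_smul_of_mem_rad hb
  exact ⟨c, by rw [map_add, L.P_of_mem_screen ha, L.P_of_mem_rad hb, add_zero]⟩

/-- If `df` vanishes on the screen then `∇^g f` is radical: `♭` restricts to the metric on the
screen, where the metric is definite. -/
theorem gradient_mem_rad {f : M → ℝ} {x : M}
    (h : ∀ v ∈ L.screen x, mvfderiv (𝓡 (n + 1)) f x v = 0) : L.gradient f x ∈ L.rad x := by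
  have hflat (w : Tan (n + 1) x) : L.flat x (L.gradient f x) w = mvfderiv (𝓡 (n + 1)) f x w :=
    LinearMap.congr_fun ((L.flatEquiv x).apply_symm_apply
      (mvfderiv (𝓡 (n + 1)) f x : Tan (n + 1) x →ₗ[ℝ] ℝ)) w
  obtain ⟨c, hc⟩ := L.exists_eq_P_add_smul_ξ x (L.gradient f x)
  have hP := L.P_mem_screen x (L.gradient f x)
  have h1 := hflat (L.P x (L.gradient f x))
  rw [h _ hP, flat_apply, L.η_of_mem_screen hP, mul_zero, add_zero] at h1
  have h2 : L.metric x (L.P x (L.gradient f x)) (L.P x (L.gradient f x)) = 0 := by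
    have h3 := congrArg (fun u ↦ L.metric x u (L.P x (L.gradient f x))) hc
    rw [h1, map_add, LinearMap.add_apply,
      L.metric_of_mem_rad_left (Submodule.smul_mem _ c (L.ξ_mem_rad x)), add_zero] at h3
    exact h3.symm
  rw [hc, L.eq_zero_of_mem_screen_of_mem_rad hP (L.mem_rad_of_metric_self h2), zero_add]
  exact Submodule.smul_mem _ _ (L.ξ_mem_rad x)

end Pointwise

section Eigen

variable {n : ℕ} {M' : Type*} [TopologicalSpace M'] [ChartedSpace (Model (n + 2)) M']
  [IsManifold (𝓡 (n + 2)) ∞ M'] {g : LorentzMetric (n + 2) M'}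
  {M : Type*} [TopologicalSpace M] [ChartedSpace (Model (n + 1)) M]
  [IsManifold (𝓡 (n + 1)) ∞ M] {L : Hypersurface n g M} {cov : AffineConnection (n + 2) M'}
  {S : Π x : M, Tan (n + 1) x →L[ℝ] Tan (n + 1) x} {lam α β : M → ℝ}

theorem HasExactlyThreeEigenfunctions.swap (h : L.HasExactlyThreeEigenfunctions S lam α β) :
    L.HasExactlyThreeEigenfunctions S lam β α where
  smooth_lam := h.smooth_lam
  smooth_α := h.smooth_β
  smooth_β := h.smooth_α
  lam_ne_α := h.lam_ne_β
  lam_ne_β := h.lam_ne_α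
  α_ne_β x := (h.α_ne_β x).symm
  hasEigenvalue_iff x c := by rw [h.hasEigenvalue_iff, or_comm (a := c = β x)]
  eigenspace_lam := h.eigenspace_lam

/-- `S` is symmetric for the Riemannian metric associated with `♭`. -/
theorem IsATensor.flat_symmetric (hS : L.IsATensor cov S)
    (h3 : L.HasExactlyThreeEigenfunctions S lam α β) (x : M) (v w : Tan (n + 1) x) :
    L.flat x (S x v) w = L.flat x v (S x w) := by
  have hη (u : Tan (n + 1) x) : L.η x (S x u) = lam x * L.η x u := by
    obtain ⟨c, hc⟩ := L.exists_eq_P_add_smul_ξ x u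
    have hξ : S x (L.ξ x) = lam x • L.ξ x := by
      rw [← mem_eigenDistribution, h3.eigenspace_lam]
      exact L.ξ_mem_rad x
    have h0 := L.η_of_mem_screen (L.P_mem_screen x u)
    have h1 := L.η_of_mem_screen (L.P_mem_screen x (S x u))
    rw [hS.screen_preserving] at h1
    rw [hc, map_add, map_add, map_add, h0, h1, map_smul, map_smul, hξ, map_smul, map_smul, L.η_ξ]
    simp only [smul_eq_mul]
    ring
  rw [flat_apply, flat_apply, hS.symmetric, hη, hη]
  ring

theorem IsATensor.sup_eigenspace_eq_top (hS : L.IsATensor cov S)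
    (h3 : L.HasExactlyThreeEigenfunctions S lam α β) (x : M) :
    Module.End.eigenspace (S x : Tan (n + 1) x →ₗ[ℝ] Tan (n + 1) x) (lam x) ⊔
      Module.End.eigenspace (S x : Tan (n + 1) x →ₗ[ℝ] Tan (n + 1) x) (α x) ⊔
      Module.End.eigenspace (S x : Tan (n + 1) x →ₗ[ℝ] Tan (n + 1) x) (β x) = ⊤ := by
  rw [eq_top_iff, ← iSup_eigenspace_eq_top_of_posDef (L.flat x)
    (fun v w ↦ by rw [flat_apply, flat_apply, metric_comm, mul_comm])
    (fun v hv ↦ L.flat_self_pos hv) (S x : Tan (n + 1) x →ₗ[ℝ] Tan (n + 1) x)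
    (hS.flat_symmetric h3 x)]
  refine iSup_le fun c ↦ ?_
  by_cases hc : Module.End.HasEigenvalue (S x : Tan (n + 1) x →ₗ[ℝ] Tan (n + 1) x) c
  · rcases (h3.hasEigenvalue_iff x c).1 hc with rfl | rfl | rfl
    · exact le_sup_left.trans le_sup_left
    · exact le_sup_right.trans le_sup_left
    · exact le_sup_right
  · rw [Module.End.hasEigenvalue_iff, not_not] at hc
    rw [hc]
    exact bot_le

theorem IsATensor.eigenDistribution_le_screen (hS : L.IsATensor cov S)
    (h3 : L.HasExactlyThreeEigenfunctions S lam α β) {x : M} {v : Tan (n + 1) x}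
    (hv : v ∈ eigenDistribution S α x) : v ∈ L.screen x := by
  have hv' := mem_eigenDistribution.1 hv
  obtain ⟨c, hc⟩ := L.exists_eq_P_add_smul_ξ x v
  have h1 : c • L.ξ x ∈ eigenDistribution S α x := by
    rw [show c • L.ξ x = v - L.P x v from (sub_eq_iff_eq_add'.2 hc).symm]
    refine Submodule.sub_mem _ hv (mem_eigenDistribution.2 ?_)
    rw [← hS.screen_preserving, hv', map_smul]
  have h2 : c • L.ξ x ∈ eigenDistribution S lam x := by
    rw [h3.eigenspace_lam]
    exact Submodule.smul_mem _ _ (L.ξ_mem_rad x)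
  have h0 : c • L.ξ x = 0 := by
    have h := (mem_eigenDistribution.1 h1).symm.trans (mem_eigenDistribution.1 h2)
    rw [← sub_eq_zero, ← sub_smul] at h
    exact (smul_eq_zero.1 h).resolve_left (sub_ne_zero.2 (h3.lam_ne_α x).symm)
  rw [hc, h0, add_zero]
  exact L.P_mem_screen x v

theorem IsATensor.metric_eq_zero (hS : L.IsATensor cov S)
    (h3 : L.HasExactlyThreeEigenfunctions S lam α β) {x : M} {v w : Tan (n + 1) x}
    (hv : v ∈ eigenDistribution S α x) (hw : w ∈ eigenDistribution S β x) :
    L.metric x v w = 0 := by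
  have h := hS.symmetric x v w
  rw [mem_eigenDistribution.1 hv, mem_eigenDistribution.1 hw, map_smul, map_smul,
    LinearMap.smul_apply, ← sub_eq_zero, ← sub_smul] at h
  exact (smul_eq_zero.1 h).resolve_left (sub_ne_zero.2 (h3.α_ne_β x))

/-- The component of a vector field in the eigendistribution of `α`, as a polynomial in `S` with
smooth coefficients, so that it is again a smooth vector field. -/
def eigenPart (S : Π x : M, Tan (n + 1) x →L[ℝ] Tan (n + 1) x) (lam α β : M → ℝ)
    (X : Π x : M, Tan (n + 1) x) (x : M) : Tan (n + 1) x :=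
  eigenProj (S x : Tan (n + 1) x →ₗ[ℝ] Tan (n + 1) x) (α x) (lam x) (β x) (X x)

theorem IsATensor.isSmoothSectionOf_eigenPart (hS : L.IsATensor cov S)
    (h3 : L.HasExactlyThreeEigenfunctions S lam α β) {X : Π x : M, Tan (n + 1) x}
    (hX : IsSmoothField X) :
    IsSmoothSectionOf (eigenDistribution S α) (eigenPart S lam α β X) := by
  constructor
  · have hSX := hS.smooth.apply hX
    have hc : ContMDiff (𝓡 (n + 1)) 𝓘(ℝ, ℝ) ∞
        (fun x ↦ ((α x - lam x) * (α x - β x))⁻¹) :=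
      ((h3.smooth_α.sub h3.smooth_lam).mul (h3.smooth_α.sub h3.smooth_β)).inv₀ fun x ↦
        mul_ne_zero (sub_ne_zero.2 (h3.lam_ne_α x).symm) (sub_ne_zero.2 (h3.α_ne_β x))
    exact (((hS.smooth.apply hSX).sub (hSX.smul (h3.smooth_lam.add h3.smooth_β))).add
      (hX.smul (h3.smooth_lam.mul h3.smooth_β))).smul hc
  · intro x
    refine eigenProj_mem ?_ (h3.lam_ne_α x).symm (h3.α_ne_β x) (X x)
    rw [← hS.sup_eigenspace_eq_top h3 x, sup_comm (Module.End.eigenspace _ (α x))]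

/-- A vector of an eigendistribution extends to a global section: extend it to a vector field and
project. -/
theorem IsATensor.exists_section [T2Space M] (hS : L.IsATensor cov S)
    (h3 : L.HasExactlyThreeEigenfunctions S lam α β) {x : M} {v : Tan (n + 1) x}
    (hv : v ∈ eigenDistribution S α x) :
    ∃ X : Π y : M, Tan (n + 1) y, IsSmoothSectionOf (eigenDistribution S α) X ∧ X x = v := by
  obtain ⟨X, hX, rfl⟩ := exists_isSmoothField x v
  exact ⟨_, hS.isSmoothSectionOf_eigenPart h3 hX,
    eigenProj_of_mem (h3.lam_ne_α x).symm (h3.α_ne_β x) hv⟩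

theorem IsATensor.exists_add_of_mem_screen (hS : L.IsATensor cov S)
    (h3 : L.HasExactlyThreeEigenfunctions S lam α β) {x : M} {v : Tan (n + 1) x}
    (hv : v ∈ L.screen x) : ∃ a ∈ eigenDistribution S α x, ∃ b ∈ eigenDistribution S β x,
      v = a + b := by
  obtain ⟨u, hu, a, ha, b, hb, h⟩ := exists_eigen_decomposition
    (hS.sup_eigenspace_eq_top h3 x) v
  have hu0 : u = 0 := by
    refine L.eq_zero_of_mem_screen_of_mem_rad ?_ (h3.eigenspace_lam x ▸ hu)
    rw [show u = v - (a + b) by rw [h]; abel]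
    exact Submodule.sub_mem _ hv (Submodule.add_mem _ (hS.eigenDistribution_le_screen h3 ha)
      (hS.eigenDistribution_le_screen h3.swap hb))
  exact ⟨a, ha, b, hb, by rw [h, hu0, zero_add]⟩

/-- A vector of the screen is the sum of its components in the two eigendistributions. -/
theorem IsATensor.eigenPart_add_eigenPart (hS : L.IsATensor cov S)
    (h3 : L.HasExactlyThreeEigenfunctions S lam α β) {X : Π x : M, Tan (n + 1) x} {x : M}
    (hX : X x ∈ L.screen x) :
    X x = eigenPart S lam α β X x + eigenPart S lam β α X x := by
  obtain ⟨v, hv, w, hw, h⟩ := hS.exists_add_of_mem_screen h3 hX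
  rw [eigenPart, eigenPart, h, map_add, map_add,
    eigenProj_of_mem (h3.lam_ne_α x).symm (h3.α_ne_β x) hv, eigenProj_of_mem_right hw,
    eigenProj_of_mem_right hv, eigenProj_of_mem (h3.lam_ne_β x).symm (h3.α_ne_β x).symm hw,
    add_zero, zero_add]

end Eigen

end Hypersurface

/-! ### The eigendistributions of an `A^∇`-tensor -/

theorem IsSmoothSectionOf.add {m : ℕ} {M : Type*} [TopologicalSpace M]
    [ChartedSpace (Model m) M] [IsManifold (𝓡 m) ∞ M] {D : Π x : M, Submodule ℝ (Tan m x)}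
    {X Y : Π x : M, Tan m x} (hX : IsSmoothSectionOf D X) (hY : IsSmoothSectionOf D Y) :
    IsSmoothSectionOf D (fun x ↦ X x + Y x) :=
  ⟨hX.1.add hY.1, fun x ↦ Submodule.add_mem _ (hX.2 x) (hY.2 x)⟩

namespace Hypersurface

section Main

variable {n : ℕ} {M' : Type*} [TopologicalSpace M'] [ChartedSpace (Model (n + 2)) M']
  [IsManifold (𝓡 (n + 2)) ∞ M'] {g : LorentzMetric (n + 2) M'}
  {M : Type*} [TopologicalSpace M] [ChartedSpace (Model (n + 1)) M]
  [IsManifold (𝓡 (n + 1)) ∞ M] {L : Hypersurface n g M} {cov : AffineConnection (n + 2) M'}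
  {S : Π x : M, Tan (n + 1) x →L[ℝ] Tan (n + 1) x} {lam α β : M → ℝ}

/-- On a section `Y` of the eigendistribution of `α`, the tensor `∇S` involves only the derivative
of `α` and the failure of `∇_X Y` to be an eigenvector. -/
theorem nablaTensor_of_section (hα : ContMDiff (𝓡 (n + 1)) 𝓘(ℝ, ℝ) ∞ α)
    (X : Π x : M, Tan (n + 1) x) {Y : Π x : M, Tan (n + 1) x}
    (hY : IsSmoothSectionOf (eigenDistribution S α) Y) (x : M) :
    L.nablaTensor cov S X Y x = mvfderiv (𝓡 (n + 1)) α x (X x) • Y x +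
      (α x • L.inducedDeriv cov Y x (X x) - S x (L.inducedDeriv cov Y x (X x))) := by
  have h : (fun y ↦ S y (Y y)) = fun y ↦ α y • Y y :=
    funext fun y ↦ mem_eigenDistribution.1 (hY.2 y)
  rw [nablaTensor, h, L.inducedDeriv_smul_field cov hα hY.1, add_sub_assoc]

theorem nablaTensor_add_field (hS : IsSmoothEndomorphism S) (X : Π x : M, Tan (n + 1) x)
    {Y Z : Π x : M, Tan (n + 1) x} (hY : IsSmoothField Y) (hZ : IsSmoothField Z) (x : M) :
    L.nablaTensor cov S X (fun y ↦ Y y + Z y) x =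
      L.nablaTensor cov S X Y x + L.nablaTensor cov S X Z x := by
  have h : (fun y ↦ S y (Y y + Z y)) = fun y ↦ S y (Y y) + S y (Z y) :=
    funext fun y ↦ map_add (S y) _ _
  rw [nablaTensor, h, L.inducedDeriv_add_field cov (hS.apply hY) (hS.apply hZ),
    L.inducedDeriv_add_field cov hY hZ, map_add, nablaTensor, nablaTensor]
  abel

/-- Pairing `(a - S) u` with an eigenvector multiplies by the difference of `a` and the
eigenvalue. -/
theorem IsATensor.metric_sub_apply (hS : L.IsATensor cov S) {x : M} {v : Tan (n + 1) x}
    (hv : v ∈ eigenDistribution S α x) (a : ℝ) (u : Tan (n + 1) x) :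
    L.metric x v (a • u - S x u) = (a - α x) * L.metric x v u := by
  rw [map_sub, ← hS.symmetric, mem_eigenDistribution.1 hv, map_smul, map_smul,
    LinearMap.smul_apply, smul_eq_mul, smul_eq_mul, sub_mul]

/-- An eigenfunction is constant along its own eigendistribution: for a section `X` of it,
`X^♭ (∇S(X, X))` is `dα(X) g(X, X)`. -/
theorem IsATensor.mvfderiv_eq_zero_of_mem [T2Space M] (hS : L.IsATensor cov S)
    (h3 : L.HasExactlyThreeEigenfunctions S lam α β) {x : M} {v : Tan (n + 1) x}
    (hv : v ∈ eigenDistribution S α x) : mvfderiv (𝓡 (n + 1)) α x v = 0 := by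
  have hs := hS.eigenDistribution_le_screen h3 hv
  obtain ⟨X, hX, rfl⟩ := hS.exists_section h3 hv
  by_cases h0 : X x ∈ L.rad x
  · rw [L.eq_zero_of_mem_screen_of_mem_rad hs h0, map_zero]
  have h := hS.killing X hX.1 x
  rw [L.flat_of_mem_screen hs, nablaTensor_of_section h3.smooth_α X hX, map_add,
    hS.metric_sub_apply hv, sub_self, zero_mul, add_zero, map_smul, smul_eq_mul] at h
  exact (mul_eq_zero.1 h).resolve_right (L.metric_self_pos h0).ne'

theorem finrank_rad (L : Hypersurface n g M) (x : M) : Module.finrank ℝ (L.rad x) = 1 := by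
  have h : L.rad x = Submodule.span ℝ {L.ξ x} := by
    refine le_antisymm (fun v hv ↦ ?_) ?_
    · obtain ⟨c, rfl⟩ := L.exists_smul_of_mem_rad hv
      exact Submodule.smul_mem _ _ (Submodule.mem_span_singleton_self _)
    · rw [Submodule.span_singleton_le_iff_mem]
      exact L.ξ_mem_rad x
  rw [h, finrank_span_singleton (L.ξ_ne_zero x)]

/-- Differentiating the trace gives a relation between `dα` and `dβ`, the coefficients of which are
the multiplicities of `α` and `β`. -/
theorem IsATensor.exists_mvfderiv_relation {lam₀ c : ℝ} (hS : L.IsATensor cov S)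
    (h3 : L.HasExactlyThreeEigenfunctions S (fun _ ↦ lam₀) α β)
    (htrace : ∀ x, LinearMap.trace ℝ (Tan (n + 1) x)
      (S x : Tan (n + 1) x →ₗ[ℝ] Tan (n + 1) x) = c) (x : M) :
    ∃ p q : ℝ, p ≠ 0 ∧ ∀ v : Tan (n + 1) x,
      p * mvfderiv (𝓡 (n + 1)) α x v + q * mvfderiv (𝓡 (n + 1)) β x v = 0 := by
  let p (y : M) : ℕ := Module.finrank ℝ (eigenDistribution S α y)
  let q (y : M) : ℕ := Module.finrank ℝ (eigenDistribution S β y)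
  have hpq (y : M) : (n : ℝ) = p y + q y ∧ c = lam₀ + α y * p y + β y * q y := by
    have h := finrank_and_trace_of_eigen_decomposition (hS.sup_eigenspace_eq_top h3 y)
      (h3.lam_ne_α y) (h3.lam_ne_β y) (h3.α_ne_β y)
    have hl : Module.finrank ℝ (Module.End.eigenspace
        (S y : Tan (n + 1) y →ₗ[ℝ] Tan (n + 1) y) lam₀) = 1 :=
      (congrArg (fun D : Submodule ℝ (Tan (n + 1) y) ↦ Module.finrank ℝ D)
        (h3.eigenspace_lam y)).trans (L.finrank_rad y)
    rw [htrace, finrank_tan, hl, Nat.cast_one, mul_one] at h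
    obtain ⟨h1, h2⟩ := h
    have h1' : ((n + 1 : ℕ) : ℝ) = 1 + p y + q y := h1
    push_cast at h1'
    exact ⟨by linear_combination h1', h2⟩
  -- the multiplicity is determined by the trace as a continuous function, so that it is locally
  -- constant
  have hcont : Continuous fun y ↦ (p y : ℝ) := by
    have h : (fun y ↦ (p y : ℝ)) = fun y ↦ (c - lam₀ - n * β y) / (α y - β y) := by
      funext y
      obtain ⟨h1, h2⟩ := hpq y
      rw [eq_div_iff (sub_ne_zero.2 (h3.α_ne_β y)), h2, h1]
      ring
    rw [h]
    exact (continuous_const.sub (continuous_const.mul h3.smooth_β.continuous)).div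
      (h3.smooth_α.continuous.sub h3.smooth_β.continuous)
      fun y ↦ sub_ne_zero.2 (h3.α_ne_β y)
  have hloc : ∀ᶠ y in 𝓝 x, p y = p x := by
    have h := (Nat.isClosedEmbedding_coe_real.isInducing.continuous_iff.2 hcont).continuousAt
      (x := x)
    exact h.eventually (IsOpen.mem_nhds (isOpen_discrete {p x}) rfl)
  have hev : (fun y ↦ (p x : ℝ) • α y + (q x : ℝ) • β y) =ᶠ[𝓝 x] fun _ ↦ c - lam₀ := by
    filter_upwards [hloc] with y hy
    obtain ⟨h1, h2⟩ := hpq y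
    have h4 : (q x : ℝ) = q y := by
      have := (hpq x).1
      rw [hy] at h1
      linear_combination h1 - this
    rw [h2, h4, ← hy, smul_eq_mul, smul_eq_mul]
    ring
  have hdα := (h3.smooth_α x).mdifferentiableAt (by simp)
  have hdβ := (h3.smooth_β x).mdifferentiableAt (by simp)
  have hp : p x ≠ 0 := fun h ↦
    ((h3.hasEigenvalue_iff x (α x)).2 (.inr (.inl rfl))) (Submodule.finrank_eq_zero.1 h)
  refine ⟨p x, q x, Nat.cast_ne_zero.2 hp, fun v ↦ ?_⟩
  have h := ((hdα.hasMFDerivAt.const_smul (p x : ℝ)).add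
    (hdβ.hasMFDerivAt.const_smul (q x : ℝ))).congr_of_eventuallyEq hev.symm
  have h' := hasMFDerivAt_unique h (hasMFDerivAt_const (c - lam₀) x)
  exact congrArg (fun T ↦ T v) h'

/-- Constancy of the trace turns the vanishing of `dβ` along its own eigendistribution into that of
`dα` there, so that `dα` vanishes on the whole screen. -/
theorem IsATensor.mvfderiv_eq_zero_of_mem_screen [T2Space M] {lam₀ c : ℝ}
    (hS : L.IsATensor cov S) (h3 : L.HasExactlyThreeEigenfunctions S (fun _ ↦ lam₀) α β)
    (htrace : ∀ x, LinearMap.trace ℝ (Tan (n + 1) x)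
      (S x : Tan (n + 1) x →ₗ[ℝ] Tan (n + 1) x) = c) {x : M} {v : Tan (n + 1) x}
    (hv : v ∈ L.screen x) : mvfderiv (𝓡 (n + 1)) α x v = 0 := by
  obtain ⟨a, ha, b, hb, rfl⟩ := hS.exists_add_of_mem_screen h3 hv
  obtain ⟨p, q, hp, h⟩ := hS.exists_mvfderiv_relation h3 htrace x
  have h' := h b
  rw [hS.mvfderiv_eq_zero_of_mem h3.swap hb, mul_zero, add_zero] at h'
  rw [map_add, hS.mvfderiv_eq_zero_of_mem h3 ha, (mul_eq_zero.1 h').resolve_left hp, add_zero]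

theorem metric_inducedDeriv_of_metric_eq_zero [T2Space M] (hcov : IsLeviCivita g cov)
    (hL : L.IsTotallyGeodesic cov) {X W : Π x : M, Tan (n + 1) x} (hX : IsSmoothField X)
    (hW : IsSmoothField W) (h : ∀ x, L.metric x (X x) (W x) = 0) (x : M) (v : Tan (n + 1) x) :
    L.metric x (X x) (L.inducedDeriv cov W x v) = -L.metric x (W x) (L.inducedDeriv cov X x v) := by
  have h1 := L.mvfderiv_metric hcov hL hX hW x v
  have h2 : (fun y ↦ L.metric y (X y) (W y)) = fun _ ↦ 0 := funext h
  have h3 : mvfderiv (𝓡 (n + 1)) (fun y ↦ L.metric y (X y) (W y)) x v = 0 := by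
    rw [h2]
    have h4 : mfderiv (𝓡 (n + 1)) 𝓘(ℝ, ℝ) (fun _ : M ↦ (0 : ℝ)) x = 0 := mfderiv_const
    exact congrArg (fun T ↦ T v) h4
  rw [h3, L.metric_comm x (L.inducedDeriv cov X x v)] at h1
  linear_combination -h1

/-- The polarized form of `X^♭ (∇S(X, X)) = 0`, for sections of the two eigendistributions. -/
theorem IsATensor.metric_inducedDeriv_add [T2Space M] (hcov : IsLeviCivita g cov)
    (hL : L.IsTotallyGeodesic cov) (hS : L.IsATensor cov S)
    (h3 : L.HasExactlyThreeEigenfunctions S lam α β)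
    (hα : ∀ x, ∀ v ∈ L.screen x, mvfderiv (𝓡 (n + 1)) α x v = 0)
    (hβ : ∀ x, ∀ v ∈ L.screen x, mvfderiv (𝓡 (n + 1)) β x v = 0)
    {X W : Π x : M, Tan (n + 1) x} (hX : IsSmoothSectionOf (eigenDistribution S α) X)
    (hW : IsSmoothSectionOf (eigenDistribution S β) W) (x : M) :
    L.metric x (W x) (L.inducedDeriv cov X x (X x + W x)) = 0 := by
  have hs : X x + W x ∈ L.screen x := Submodule.add_mem _
    (hS.eigenDistribution_le_screen h3 (hX.2 x)) (hS.eigenDistribution_le_screen h3.swap (hW.2 x))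
  have hmove := metric_inducedDeriv_of_metric_eq_zero hcov hL hX.1 hW.1
    (fun y ↦ hS.metric_eq_zero h3 (hX.2 y) (hW.2 y)) x (X x + W x)
  have h := hS.killing (fun y ↦ X y + W y) (hX.1.add hW.1) x
  rw [L.flat_of_mem_screen hs, nablaTensor_add_field hS.smooth _ hX.1 hW.1,
    nablaTensor_of_section h3.smooth_α _ hX, nablaTensor_of_section h3.smooth_β _ hW,
    hα x _ hs, hβ x _ hs, zero_smul, zero_smul, zero_add, zero_add, map_add, map_add,
    LinearMap.add_apply, LinearMap.add_apply, hS.metric_sub_apply (hX.2 x),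
    hS.metric_sub_apply (hX.2 x), hS.metric_sub_apply (hW.2 x), hS.metric_sub_apply (hW.2 x),
    hmove] at h
  have h' : (2 * (α x - β x)) * L.metric x (W x) (L.inducedDeriv cov X x (X x + W x)) = 0 := by
    linear_combination h
  exact (mul_eq_zero.1 h').resolve_left (mul_ne_zero two_ne_zero (sub_ne_zero.2 (h3.α_ne_β x)))

/-- `∇_X X` is orthogonal to the other eigendistribution, for `X` in one of them. -/
theorem IsATensor.metric_inducedDeriv_self [T2Space M] (hcov : IsLeviCivita g cov)
    (hL : L.IsTotallyGeodesic cov) (hS : L.IsATensor cov S)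
    (h3 : L.HasExactlyThreeEigenfunctions S lam α β)
    (hα : ∀ x, ∀ v ∈ L.screen x, mvfderiv (𝓡 (n + 1)) α x v = 0)
    (hβ : ∀ x, ∀ v ∈ L.screen x, mvfderiv (𝓡 (n + 1)) β x v = 0)
    {X W : Π x : M, Tan (n + 1) x} (hX : IsSmoothSectionOf (eigenDistribution S α) X)
    (hW : IsSmoothSectionOf (eigenDistribution S β) W) (x : M) :
    L.metric x (W x) (L.inducedDeriv cov X x (X x)) = 0 := by
  -- the relation for `W` and for `2 W` separates its linear and quadratic parts in `W`
  have h1 := hS.metric_inducedDeriv_add hcov hL h3 hα hβ hX hW x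
  have h2 := hS.metric_inducedDeriv_add hcov hL h3 hα hβ hX (hW.add hW) x
  simp only [inducedDeriv_add, map_add, LinearMap.add_apply] at h1 h2
  linear_combination 2 * h1 - h2 / 2

/-- If the eigendistribution of `α` is integrable, the derivative of one of its sections along
another is orthogonal to the eigendistribution of `β`: the symmetric part of this derivative is so
by polarization, and the skew part is a Lie bracket. -/
theorem IsATensor.metric_inducedDeriv [T2Space M] (hcov : IsLeviCivita g cov)
    (hL : L.IsTotallyGeodesic cov) (hS : L.IsATensor cov S)
    (h3 : L.HasExactlyThreeEigenfunctions S lam α β)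
    (hα : ∀ x, ∀ v ∈ L.screen x, mvfderiv (𝓡 (n + 1)) α x v = 0)
    (hβ : ∀ x, ∀ v ∈ L.screen x, mvfderiv (𝓡 (n + 1)) β x v = 0)
    (hint : IsIntegrable (eigenDistribution S α))
    {X Z W : Π x : M, Tan (n + 1) x} (hX : IsSmoothSectionOf (eigenDistribution S α) X)
    (hZ : IsSmoothSectionOf (eigenDistribution S α) Z)
    (hW : IsSmoothSectionOf (eigenDistribution S β) W) (x : M) :
    L.metric x (W x) (L.inducedDeriv cov Z x (X x)) = 0 := by
  have h1 := hS.metric_inducedDeriv_self hcov hL h3 hα hβ hX hW x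
  have h2 := hS.metric_inducedDeriv_self hcov hL h3 hα hβ hZ hW x
  have h4 := hS.metric_inducedDeriv_self hcov hL h3 hα hβ (hX.add hZ) hW x
  rw [L.inducedDeriv_add_field cov hX.1 hZ.1, inducedDeriv_add, inducedDeriv_add] at h4
  simp only [map_add] at h4
  have h5 := hS.metric_eq_zero h3 (hint X Z hX hZ x) (hW.2 x)
  rw [metric_comm, ← L.inducedDeriv_sub_inducedDeriv hcov hX.1 hZ.1, map_sub] at h5
  linear_combination (h4 + h5 - h1 - h2) / 2

/-- A screen vector orthogonal to one eigendistribution lies in the other. -/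
theorem IsATensor.mem_eigenDistribution_of_metric (hS : L.IsATensor cov S)
    (h3 : L.HasExactlyThreeEigenfunctions S lam α β) {x : M} {u : Tan (n + 1) x}
    (hu : u ∈ L.screen x) (h : ∀ w ∈ eigenDistribution S β x, L.metric x w u = 0) :
    u ∈ eigenDistribution S α x := by
  obtain ⟨a, ha, b, hb, rfl⟩ := hS.exists_add_of_mem_screen h3 hu
  have h1 := h b hb
  rw [map_add, metric_comm, hS.metric_eq_zero h3 ha hb, zero_add] at h1
  rwa [L.eq_zero_of_mem_screen_of_mem_rad (hS.eigenDistribution_le_screen h3.swap hb)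
    (L.mem_rad_of_metric_self h1), add_zero]

/-- If both eigendistributions are integrable and the screen is totally geodesic, every section of
an eigendistribution has its derivatives along the screen in that eigendistribution. Along the
other eigendistribution this follows from the integrability of the latter, since the connection is
metric. -/
theorem IsATensor.nablaTensor_eq_zero_of_section [T2Space M] (hcov : IsLeviCivita g cov)
    (hL : L.IsTotallyGeodesic cov) (hS : L.IsATensor cov S)
    (h3 : L.HasExactlyThreeEigenfunctions S lam α β)
    (hα : ∀ x, ∀ v ∈ L.screen x, mvfderiv (𝓡 (n + 1)) α x v = 0)
    (hβ : ∀ x, ∀ v ∈ L.screen x, mvfderiv (𝓡 (n + 1)) β x v = 0)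
    (hsc : L.IsScreenTotallyGeodesic cov)
    (hintα : IsIntegrable (eigenDistribution S α))
    (hintβ : IsIntegrable (eigenDistribution S β))
    {X Y : Π x : M, Tan (n + 1) x} (hX : IsSmoothSectionOf L.screen X)
    (hY : IsSmoothSectionOf (eigenDistribution S α) Y) (x : M) :
    L.nablaTensor cov S X Y x = 0 := by
  have hu : L.inducedDeriv cov Y x (X x) ∈ L.screen x := by
    have h := hsc X Y hX.1 ⟨hY.1, fun y ↦ hS.eigenDistribution_le_screen h3 (hY.2 y)⟩ x
    rw [sub_eq_zero.1 h]
    exact L.P_mem_screen x _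
  have hmem : L.inducedDeriv cov Y x (X x) ∈ eigenDistribution S α x := by
    refine hS.mem_eigenDistribution_of_metric h3 hu fun w hw ↦ ?_
    obtain ⟨W, hW, rfl⟩ := hS.exists_section h3.swap hw
    have hXα := hS.isSmoothSectionOf_eigenPart h3 hX.1
    have hXβ := hS.isSmoothSectionOf_eigenPart h3.swap hX.1
    have h1 := hS.metric_inducedDeriv hcov hL h3 hα hβ hintα hXα hY hW x
    have h2 := hS.metric_inducedDeriv hcov hL h3.swap hβ hα hintβ hXβ hW hY x
    rw [metric_inducedDeriv_of_metric_eq_zero hcov hL hY.1 hW.1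
      (fun y ↦ hS.metric_eq_zero h3 (hY.2 y) (hW.2 y)), neg_eq_zero] at h2
    rw [hS.eigenPart_add_eigenPart h3 (hX.2 x), inducedDeriv_add, map_add, h1, h2, add_zero]
  rw [nablaTensor_of_section h3.smooth_α X hY, hα x _ (hX.2 x), zero_smul,
    mem_eigenDistribution.1 hmem, sub_self, add_zero]

theorem IsATensor.isIntegrable_of_nablaTensor [T2Space M] (hcov : IsLeviCivita g cov)
    (hS : L.IsATensor cov S) (h3 : L.HasExactlyThreeEigenfunctions S lam α β)
    (h : ∀ X Y : Π x : M, Tan (n + 1) x, IsSmoothSectionOf L.screen X →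
      IsSmoothSectionOf L.screen Y → ∀ x, L.nablaTensor cov S X Y x = 0) :
    IsIntegrable (eigenDistribution S α) := by
  have key {X Y : Π x : M, Tan (n + 1) x} (hX : IsSmoothSectionOf (eigenDistribution S α) X)
      (hY : IsSmoothSectionOf (eigenDistribution S α) Y) (x : M) :
      L.inducedDeriv cov Y x (X x) ∈ eigenDistribution S α x := by
    have h1 := h X Y ⟨hX.1, fun y ↦ hS.eigenDistribution_le_screen h3 (hX.2 y)⟩
      ⟨hY.1, fun y ↦ hS.eigenDistribution_le_screen h3 (hY.2 y)⟩ x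
    rw [nablaTensor_of_section h3.smooth_α X hY, hS.mvfderiv_eq_zero_of_mem h3 (hX.2 x),
      zero_smul, zero_add, sub_eq_zero] at h1
    exact mem_eigenDistribution.2 h1.symm
  intro X Y hX hY x
  rw [← L.inducedDeriv_sub_inducedDeriv hcov hX.1 hY.1]
  exact Submodule.sub_mem _ (key hX hY x) (key hY hX x)

end Main

end Hypersurface

end Lightlike

theorem theorem5p1 (n : ℕ)
    {M' : Type*} [TopologicalSpace M'] [ChartedSpace (Lightlike.Model (n + 2)) M']
    [IsManifold (𝓡 (n + 2)) ∞ M']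
    {M : Type*} [TopologicalSpace M] [T2Space M] [ChartedSpace (Lightlike.Model (n + 1)) M]
    [IsManifold (𝓡 (n + 1)) ∞ M]
    (g : Lightlike.LorentzMetric (n + 2) M')
    (cov : Lightlike.AffineConnection (n + 2) M') (hcov : Lightlike.IsLeviCivita g cov)
    (L : Lightlike.Hypersurface n g M) (hL : L.IsTotallyGeodesic cov)
    (S : Π x : M, Lightlike.Tan (n + 1) x →L[ℝ] Lightlike.Tan (n + 1) x)
    (hS : L.IsATensor cov S)
    (lam₀ : ℝ) (α β : M → ℝ)
    (hS3 : L.HasExactlyThreeEigenfunctions S (fun _ ↦ lam₀) α β)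
    (c : ℝ) (htrace : ∀ x, LinearMap.trace ℝ (Lightlike.Tan (n + 1) x)
      (S x : Lightlike.Tan (n + 1) x →ₗ[ℝ] Lightlike.Tan (n + 1) x) = c) :
    (∀ x, L.gradient α x ∈ L.rad x ∧ L.gradient β x ∈ L.rad x) ∧
    (L.IsScreenTotallyGeodesic cov →
      ((Lightlike.IsIntegrable (Lightlike.eigenDistribution S α) ∧
          Lightlike.IsIntegrable (Lightlike.eigenDistribution S β)) ↔
        ∀ X Y : Π x : M, Lightlike.Tan (n + 1) x,
          Lightlike.IsSmoothSectionOf L.screen X → Lightlike.IsSmoothSectionOf L.screen Y →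
            ∀ x, L.nablaTensor cov S X Y x = 0)) := by
  have hα : ∀ x, ∀ v ∈ L.screen x, mvfderiv (𝓡 (n + 1)) α x v = 0 :=
    fun _ _ hv ↦ hS.mvfderiv_eq_zero_of_mem_screen hS3 htrace hv
  have hβ : ∀ x, ∀ v ∈ L.screen x, mvfderiv (𝓡 (n + 1)) β x v = 0 :=
    fun _ _ hv ↦ hS.mvfderiv_eq_zero_of_mem_screen hS3.swap htrace hv
  refine ⟨fun x ↦ ⟨L.gradient_mem_rad (hα x), L.gradient_mem_rad (hβ x)⟩,
    fun hsc ↦ ⟨fun ⟨hintα, hintβ⟩ X Y hX hY x ↦ ?_, fun h ↦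
      ⟨hS.isIntegrable_of_nablaTensor hcov hS3 h, hS.isIntegrable_of_nablaTensor hcov hS3.swap h⟩⟩⟩
  have hYα := hS.isSmoothSectionOf_eigenPart hS3 hY.1
  have hYβ := hS.isSmoothSectionOf_eigenPart hS3.swap hY.1
  rw [show Y = fun y ↦ Lightlike.Hypersurface.eigenPart S (fun _ ↦ lam₀) α β Y y +
      Lightlike.Hypersurface.eigenPart S (fun _ ↦ lam₀) β α Y y from
    funext fun y ↦ hS.eigenPart_add_eigenPart hS3 (hY.2 y),
    Lightlike.Hypersurface.nablaTensor_add_field hS.smooth X hYα.1 hYβ.1,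
    hS.nablaTensor_eq_zero_of_section hcov hL hS3 hα hβ hsc hintα hintβ hX hYα,
    hS.nablaTensor_eq_zero_of_section hcov hL hS3.swap hβ hα hsc hintβ hintα hX hYβ, add_zero]
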